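/- Let $q\in\mathbb C$ with $|q|=1$ not be a root of unity, fix a square root $q^{1/2}$ of $q$, and let $\mu,\nu\in\mathbb R$. Let $A=SL_q(2,\mathbb R)$ be the unital complex $*$-algebra generated by four real (self-adjoint) elements $a,b,c,d$ with relations $$ab=q\,ba,\quad ac=q\,ca,\quad bc=cb,\quad bd=q\,db,\quad cd=q\,dc,\quad da-q^{-1}bc=1=ad-q\,bc,$$ with the coproduct $\Delta:A\to A\otimes A$, the algebra homomorphism given by $\Delta a=a\otimes a+b\otimes c$, $\Delta b=a\otimes b+b\otimes d$, $\Delta c=c\otimes a+d\otimes c$, $\Delta d=c\otimes b+d\otimes d$. Let $\mathcal C_{\mu\nu}\subset A$ be the linear span of $a-d+2q^{1/2}\mu\,b$ and $q\nu\,b+c$, let $\mathcal R_{\mu\nu}=\mathcal C_{\mu\nu}A$ be the right ideal it generates, let $r_{\mu\nu}:A\to A/\mathcal R_{\mu\nu}$ be the quotient map, and let $$B^{r_{\mu\nu}}=\{x\in A:\ (\mathrm{id}\otimes r_{\mu\nu})\Delta x=x\otimes r_{\mu\nu}(1)\}$$ be the quantum homogeneous space of right coinvariants. Put $$z_1=q^{-1/2}(ac+\nu\,bd)+2\mu\,bc,\qquad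 z_2=c^2+\nu\,d^2+2\mu q^{-1/2}cd,\qquad z_3=a^2+\nu\,b^2+2\mu q^{-1/2}ab .$$ Then $B^{r_{\mu\nu}}$ is a left comodule subalgebra of $A$ (a unital subalgebra with $\Delta(B^{r_{\mu\nu}})\subset A\otimes B^{r_{\mu\nu}}$), and it is generated as a unital complex algebra by $z_1,z_2,z_3$. The elements $z_1,z_2,z_3$ are real ($z_i^*=z_i$) and satisfy $$z_1z_2=q^2z_2z_1,\qquad z_1z_3=q^{-2}z_3z_1,\qquad z_3z_2=\nu+q^2z_1^2+2\mu q\,z_1 .$$ -/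

import Mathlib

open scoped TensorProduct

noncomputable section

namespace SLq

/-- The names of the four generators of the function algebra on `SL_q(2, ℝ)`. -/
inductive Gen : Type
  | a | b | c | d

/-- The generators, as elements of the free complex algebra on them. -/
abbrev free (g : Gen) : FreeAlgebra ℂ Gen := FreeAlgebra.ι ℂ g

/-- The defining relations of the function algebra on `SL_q(2, ℝ)`. -/
inductive Rel (q : ℂ) : FreeAlgebra ℂ Gen → FreeAlgebra ℂ Gen → Prop
  | ab : Rel q (free .a * free .b) (q • (free .b * free .a))
  | ac : Rel q (free .a * free .c) (q • (free .c * free .a))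
  | bc : Rel q (free .b * free .c) (free .c * free .b)
  | bd : Rel q (free .b * free .d) (q • (free .d * free .b))
  | cd : Rel q (free .c * free .d) (q • (free .d * free .c))
  | da : Rel q (free .d * free .a - q⁻¹ • (free .b * free .c)) 1
  | ad : Rel q (free .a * free .d - q • (free .b * free .c)) 1

/-- The function algebra on the quantum group `SL_q(2, ℝ)`, where `q` is a complex number of
modulus one: the unital complex algebra generated by `a, b, c, d` with the relations `Rel`. -/
def Fun (q : Circle) : Type := RingQuot (Rel (q : ℂ))

variable (q : Circle)

instance : Ring (Fun q) := inferInstanceAs (Ring (RingQuot (Rel (q : ℂ))))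

instance : Algebra ℂ (Fun q) := inferInstanceAs (Algebra ℂ (RingQuot (Rel (q : ℂ))))

/-- The generators of the function algebra. -/
def gen (g : Gen) : Fun q := RingQuot.mkAlgHom ℂ (Rel (q : ℂ)) (free g)

abbrev a : Fun q := gen q .a
abbrev b : Fun q := gen q .b
abbrev c : Fun q := gen q .c
abbrev d : Fun q := gen q .d

theorem rel_ab : a q * b q = (q : ℂ) • (b q * a q) := by
  simpa using! RingQuot.mkAlgHom_rel ℂ (Rel.ab (q := (q : ℂ)))

theorem rel_ac : a q * c q = (q : ℂ) • (c q * a q) := by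
  simpa using! RingQuot.mkAlgHom_rel ℂ (Rel.ac (q := (q : ℂ)))

theorem rel_bc : b q * c q = c q * b q := by
  simpa using! RingQuot.mkAlgHom_rel ℂ (Rel.bc (q := (q : ℂ)))

theorem rel_bd : b q * d q = (q : ℂ) • (d q * b q) := by
  simpa using! RingQuot.mkAlgHom_rel ℂ (Rel.bd (q := (q : ℂ)))

theorem rel_cd : c q * d q = (q : ℂ) • (d q * c q) := by
  simpa using! RingQuot.mkAlgHom_rel ℂ (Rel.cd (q := (q : ℂ)))

theorem rel_da : d q * a q - (q : ℂ)⁻¹ • (b q * c q) = 1 := by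
  simpa using! RingQuot.mkAlgHom_rel ℂ (Rel.da (q := (q : ℂ)))

theorem rel_ad : a q * d q - (q : ℂ) • (b q * c q) = 1 := by
  simpa using! RingQuot.mkAlgHom_rel ℂ (Rel.ad (q := (q : ℂ)))

section lift

variable {q} {T : Type*} [Ring T] [Algebra ℂ T]

/-- The universal property: an algebra homomorphism out of the function algebra is given by the
images of the four generators, which have to satisfy the relations. -/
def lift (f : Gen → T)
    (hab : f .a * f .b = (q : ℂ) • (f .b * f .a))
    (hac : f .a * f .c = (q : ℂ) • (f .c * f .a))
    (hbc : f .b * f .c = f .c * f .b)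
    (hbd : f .b * f .d = (q : ℂ) • (f .d * f .b))
    (hcd : f .c * f .d = (q : ℂ) • (f .d * f .c))
    (hda : f .d * f .a - (q : ℂ)⁻¹ • (f .b * f .c) = 1)
    (had : f .a * f .d - (q : ℂ) • (f .b * f .c) = 1) : Fun q →ₐ[ℂ] T :=
  RingQuot.liftAlgHom ℂ ⟨FreeAlgebra.lift ℂ f, by
    intro x y h
    cases h <;> simpa using by assumption⟩

@[simp]
theorem lift_gen (f : Gen → T) (h₁ h₂ h₃ h₄ h₅ h₆ h₇) (g : Gen) :
    lift (q := q) f h₁ h₂ h₃ h₄ h₅ h₆ h₇ (gen q g) = f g := by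
  exact (RingQuot.liftAlgHom_mkAlgHom_apply ℂ (FreeAlgebra.lift ℂ f) _ (free g)).trans
    (FreeAlgebra.lift_ι_apply f g)

theorem hom_ext {f₁ f₂ : Fun q →ₐ[ℂ] T} (h : ∀ g, f₁ (gen q g) = f₂ (gen q g)) : f₁ = f₂ := by
  refine RingQuot.ringQuot_ext' ℂ (s := Rel (q : ℂ)) f₁ f₂ ?_
  refine FreeAlgebra.hom_ext ?_
  funext g
  exact h g

end lift

/-! Rewriting rules for products of two generators. -/

theorem mul_ba : b q * a q = (q : ℂ)⁻¹ • (a q * b q) := by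
  rw [rel_ab, smul_smul, inv_mul_cancel₀ q.coe_ne_zero, one_smul]

theorem mul_ca : c q * a q = (q : ℂ)⁻¹ • (a q * c q) := by
  rw [rel_ac, smul_smul, inv_mul_cancel₀ q.coe_ne_zero, one_smul]

theorem mul_db : d q * b q = (q : ℂ)⁻¹ • (b q * d q) := by
  rw [rel_bd, smul_smul, inv_mul_cancel₀ q.coe_ne_zero, one_smul]

theorem mul_dc : d q * c q = (q : ℂ)⁻¹ • (c q * d q) := by
  rw [rel_cd, smul_smul, inv_mul_cancel₀ q.coe_ne_zero, one_smul]

theorem mul_da : d q * a q = 1 + (q : ℂ)⁻¹ • (b q * c q) := sub_eq_iff_eq_add.mp (rel_da q)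

theorem mul_ad : a q * d q = 1 + (q : ℂ) • (b q * c q) := sub_eq_iff_eq_add.mp (rel_ad q)

/-- The values of the coproduct on the generators: `Δ T = T ⊗ T` for the matrix
`T = (a, b; c, d)`. -/
def comulGen : Gen → Fun q ⊗[ℂ] Fun q
  | .a => a q ⊗ₜ a q + b q ⊗ₜ c q
  | .b => a q ⊗ₜ b q + b q ⊗ₜ d q
  | .c => c q ⊗ₜ a q + d q ⊗ₜ c q
  | .d => c q ⊗ₜ b q + d q ⊗ₜ d q

/-- The coproduct of the function algebra. -/
def comulHom : Fun q →ₐ[ℂ] Fun q ⊗[ℂ] Fun q := by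
  have hq : (q : ℂ) ≠ 0 := q.coe_ne_zero
  refine lift (comulGen q) ?_ ?_ ?_ ?_ ?_ ?_ ?_ <;>
  · simp only [comulGen, mul_add, add_mul, Algebra.TensorProduct.tmul_mul_tmul, mul_ba, mul_ca,
      mul_db, mul_dc, mul_da, mul_ad, ← rel_bc, TensorProduct.tmul_add, TensorProduct.add_tmul,
      TensorProduct.tmul_smul, ← TensorProduct.smul_tmul', Algebra.TensorProduct.one_def]
    match_scalars <;> field_simp <;> ring

/-- The values of the counit on the generators. -/
def counitGen : Gen → ℂ
  | .a => 1
  | .b => 0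
  | .c => 0
  | .d => 1

/-- The counit of the function algebra. -/
def counitHom : Fun q →ₐ[ℂ] ℂ :=
  lift counitGen (by simp [counitGen]) (by simp [counitGen]) (by simp [counitGen])
    (by simp [counitGen]) (by simp [counitGen]) (by simp [counitGen]) (by simp [counitGen])

theorem comulHom_gen (g : Gen) : comulHom q (gen q g) = comulGen q g := by
  simp [comulHom]

theorem counitHom_gen (g : Gen) : counitHom q (gen q g) = counitGen g := by
  simp [counitHom]

instance : Bialgebra ℂ (Fun q) :=
  Bialgebra.ofAlgHom (comulHom q) (counitHom q)
    (by
      refine hom_ext fun g => ?_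
      cases g <;> simp [comulHom_gen, comulGen, TensorProduct.add_tmul, TensorProduct.tmul_add] <;>
        abel)
    (by
      refine hom_ext fun g => ?_
      cases g <;> simp [comulHom_gen, comulGen, counitHom_gen, counitGen])
    (by
      refine hom_ext fun g => ?_
      cases g <;> simp [comulHom_gen, comulGen, counitHom_gen, counitGen])

/-- The opposite of the function algebra, with `ℂ` acting through complex conjugation; algebra
homomorphisms into it are antilinear antimultiplicative maps into the function algebra. -/
def ConjOp : Type := (Fun q)ᵐᵒᵖ

instance : Ring (ConjOp q) := inferInstanceAs (Ring (Fun q)ᵐᵒᵖ)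

instance : Algebra ℂ (ConjOp q) := Algebra.compHom (Fun q)ᵐᵒᵖ (starRingEnd ℂ)

/-- The identity map into the conjugate opposite algebra. -/
def toConjOp (x : Fun q) : ConjOp q := MulOpposite.op x

/-- The identity map from the conjugate opposite algebra. -/
def ofConjOp (x : ConjOp q) : Fun q := MulOpposite.unop x

@[simp] theorem of_to (x : Fun q) : ofConjOp q (toConjOp q x) = x := rfl
@[simp] theorem to_of (x : ConjOp q) : toConjOp q (ofConjOp q x) = x := rfl
theorem to_mul (x y : Fun q) : toConjOp q (x * y) = toConjOp q y * toConjOp q x := rfl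
theorem to_add (x y : Fun q) : toConjOp q (x + y) = toConjOp q x + toConjOp q y := rfl
theorem to_sub (x y : Fun q) : toConjOp q (x - y) = toConjOp q x - toConjOp q y := rfl
theorem to_one : toConjOp q 1 = 1 := rfl
theorem of_mul (x y : ConjOp q) : ofConjOp q (x * y) = ofConjOp q y * ofConjOp q x := rfl
theorem of_add (x y : ConjOp q) : ofConjOp q (x + y) = ofConjOp q x + ofConjOp q y := rfl
theorem of_zero : ofConjOp q 0 = 0 := rfl
theorem of_one : ofConjOp q 1 = 1 := rfl

theorem smul_to (z : ℂ) (x : Fun q) :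
    z • toConjOp q x = toConjOp q ((starRingEnd ℂ z) • x) := rfl

theorem of_smul (z : ℂ) (x : ConjOp q) :
    ofConjOp q (z • x) = (starRingEnd ℂ z) • ofConjOp q x := rfl

/-- The involution, as a homomorphism into the conjugate opposite algebra; it is the identity on
the four generators. -/
def starHom : Fun q →ₐ[ℂ] ConjOp q := by
  have hq : (q : ℂ) ≠ 0 := q.coe_ne_zero
  have hc : (starRingEnd ℂ) (q : ℂ) = (q : ℂ)⁻¹ := by
    rw [← Circle.coe_inv_eq_conj, Circle.coe_inv]
  refine lift (fun g => toConjOp q (gen q g)) ?_ ?_ ?_ ?_ ?_ ?_ ?_ <;>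
  simp only [← to_mul, smul_to, ← to_sub, ← to_one, hc, map_inv₀, inv_inv] <;> congr 1
  · exact mul_ba q
  · exact mul_ca q
  · exact (rel_bc q).symm
  · exact mul_db q
  · exact mul_dc q
  · rw [← rel_bc]; exact rel_ad q
  · rw [← rel_bc]; exact rel_da q

/-- The `*`-structure of `SL_q(2, ℝ)`: the antilinear antimultiplicative involution for which
`a, b, c, d` are real. -/
instance : Star (Fun q) := ⟨fun x => ofConjOp q (starHom q x)⟩

theorem star_def (x : Fun q) : star x = ofConjOp q (starHom q x) := rfl

theorem star_gen (g : Gen) : star (gen q g) = gen q g := by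
  simp [star_def, starHom]

theorem star_mul_aux (x y : Fun q) : star (x * y) = star y * star x := by
  simp [star_def, of_mul]

theorem star_add_aux (x y : Fun q) : star (x + y) = star x + star y := by
  simp [star_def, of_add]

theorem star_smul_aux (z : ℂ) (x : Fun q) : star (z • x) = star z • star x := by
  simp [star_def, of_smul]

theorem star_one_aux : star (1 : Fun q) = 1 := by
  simp [star_def, of_one]

/-- The square of the involution, as a homomorphism of complex algebras. -/
def starStarHom : Fun q →ₐ[ℂ] Fun q where
  toFun x := star (star x)
  map_one' := by simp [star_one_aux]
  map_mul' x y := by simp [star_mul_aux]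
  map_zero' := by simp [star_def, of_zero]
  map_add' x y := by simp [star_add_aux]
  commutes' z := by simp [Algebra.algebraMap_eq_smul_one, star_smul_aux, star_one_aux]

theorem star_star_aux (x : Fun q) : star (star x) = x := by
  have h : starStarHom q = AlgHom.id ℂ (Fun q) := hom_ext fun g => by
    simp [starStarHom, star_gen]
  exact DFunLike.congr_fun h x

instance : StarRing (Fun q) where
  star_involutive := star_star_aux q
  star_mul := star_mul_aux q
  star_add := star_add_aux q

instance : StarModule ℂ (Fun q) := ⟨star_smul_aux q⟩

/-! In the following definitions `s` is a square root `q^{1/2}` of `q`. -/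

variable (s : Circle) (μ ν : ℝ)

/-- The linear span of `a - d + 2 q^{1/2} μ b` and `q ν b + c`. -/
def coideal : Submodule ℂ (Fun q) :=
  Submodule.span ℂ
    {a q - d q + (2 * s * μ : ℂ) • b q, (q * ν : ℂ) • b q + c q}

/-- The right ideal `coideal * Fun q` generated by the coideal, as a linear subspace. -/
def rightIdeal : Submodule ℂ (Fun q) := coideal q s μ ν * ⊤

/-- The (space underlying the) coisotropic quantum right subgroup: the quotient of the function
algebra by the right ideal. -/
abbrev Subgp : Type := Fun q ⧸ rightIdeal q s μ ν

/-- The quotient map onto the coisotropic quantum subgroup. -/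
def proj : Fun q →ₗ[ℂ] Subgp q s μ ν := (rightIdeal q s μ ν).mkQ

/-- The quantum homogeneous space of right coinvariants
`{x | (id ⊗ r) (Δ x) = x ⊗ r 1}`, where `r` is the quotient map. -/
def homogeneousSpace : Submodule ℂ (Fun q) where
  carrier := {x | (proj q s μ ν).lTensor (Fun q) (Coalgebra.comul (R := ℂ) x)
    = x ⊗ₜ[ℂ] proj q s μ ν 1}
  zero_mem' := by simp
  add_mem' {x y} hx hy := by
    simp only [Set.mem_ofPred_eq] at hx hy ⊢
    simp only [map_add, hx, hy, TensorProduct.add_tmul]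
  smul_mem' z x hx := by
    simp only [Set.mem_ofPred_eq] at hx ⊢
    simp only [map_smul, hx, TensorProduct.smul_tmul']

/-- `z₁ = q^{-1/2} (a c + ν b d) + 2 μ b c`. -/
def z₁ : Fun q :=
  (s⁻¹ : ℂ) • (a q * c q + (ν : ℂ) • (b q * d q)) + (2 * μ : ℂ) • (b q * c q)

/-- `z₂ = c² + ν d² + 2 μ q^{-1/2} c d`. -/
def z₂ : Fun q :=
  c q ^ 2 + (ν : ℂ) • d q ^ 2 + (2 * μ * s⁻¹ : ℂ) • (c q * d q)

/-- `z₃ = a² + ν b² + 2 μ q^{-1/2} a b`. -/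
def z₃ : Fun q :=
  a q ^ 2 + (ν : ℂ) • b q ^ 2 + (2 * μ * s⁻¹ : ℂ) • (a q * b q)

end SLq

end

/-!
Write `T` for the matrix `(a, b; c, d)` and `B` for `(1, 2 μ q^{-1/2}; 0, ν)`. The quotient map `r`
sends `T B Tᵗ` to `B`, which makes the entries of `T B Tᵗ` coinvariant; up to scalars and constants
these are `z₁`, `z₂` and `z₃`.

Conversely, every functional that kills the right ideal acts on a coinvariant by a scalar. Two such
functionals suffice. One is the character `T ↦ -1`, by which coinvariants have even degree. The
other is a twisted primitive functional; coinvariants are killed by the corresponding skew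
derivation. In the basis of ordered monomials, sorted by degree and by the row and column weights of
the factors, this skew derivation acts on leading symbols by a tridiagonal matrix whose
superdiagonal entries `q (q ^ j - q ^ (-j))` do not vanish, as `q` is not a root of unity. Hence the
leading symbol of a coinvariant is determined by its column of weight zero. In degree `2 n` products
of `n` of the `zᵢ` realize every such column, and subtracting them lowers the degree.
-/

noncomputable section

namespace QuantumHomogeneous

section Coalgebra

variable {R C M : Type*} [CommRing R] [AddCommGroup C] [Module R C] [Coalgebra R C]
  [AddCommGroup M] [Module R M]

/-- The coinvariants `{x | (id ⊗ π) (Δ x) = x ⊗ m}` of a coalgebra under a linear map `π` and a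
base point `m` of its target; quantum homogeneous spaces are the case of a quotient map `π` of a
bialgebra and `m = π 1`. -/
def coinvariants (π : C →ₗ[R] M) (m : M) : Submodule R C :=
  LinearMap.eqLocus (π.lTensor C ∘ₗ Coalgebra.comul) ((TensorProduct.mk R C M).flip m)

theorem mem_coinvariants {π : C →ₗ[R] M} {m : M} {x : C} :
    x ∈ coinvariants π m ↔ π.lTensor C (Coalgebra.comul x) = x ⊗ₜ[R] m :=
  Iff.rfl

theorem lTensor_comul_assoc (π : C →ₗ[R] M) (x : C) :
    (π.lTensor C ∘ₗ Coalgebra.comul).lTensor C (Coalgebra.comul x) =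
      TensorProduct.assoc R C C M
        ((Coalgebra.comul (R := R)).rTensor M (π.lTensor C (Coalgebra.comul x))) := by
  have naturality (t : (C ⊗[R] C) ⊗[R] C) :
      (π.lTensor C).lTensor C (TensorProduct.assoc R C C C t) =
        TensorProduct.assoc R C C M (π.lTensor (C ⊗[R] C) t) :=
    LinearMap.congr_fun (f := (π.lTensor C).lTensor C ∘ₗ (TensorProduct.assoc R C C C).toLinearMap)
      (g := (TensorProduct.assoc R C C M).toLinearMap ∘ₗ π.lTensor (C ⊗[R] C))
      (TensorProduct.ext_threefold fun _ _ _ => rfl) t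
  rw [LinearMap.lTensor_comp, LinearMap.comp_apply, ← Coalgebra.coassoc_apply, naturality,
    ← LinearMap.comp_apply, LinearMap.lTensor_comp_rTensor, ← LinearMap.rTensor_comp_lTensor,
    LinearMap.comp_apply]

theorem comul_mem_range_lTensor_coinvariants [Module.Flat R C] {π : C →ₗ[R] M} {m : M} {x : C}
    (hx : x ∈ coinvariants π m) :
    Coalgebra.comul x ∈ LinearMap.range ((coinvariants π m).subtype.lTensor C) := by
  have insert_comul (t : C ⊗[R] C) :
      TensorProduct.assoc R C C M (t ⊗ₜ m) = ((TensorProduct.mk R C M).flip m).lTensor C t := by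
    induction t with
    | zero => simp
    | add t u ht hu => simp only [TensorProduct.add_tmul, map_add, ht, hu]
    | tmul y z => rfl
  refine (Module.Flat.eqLocus_lTensor_eq R C (π.lTensor C ∘ₗ Coalgebra.comul)
    ((TensorProduct.mk R C M).flip m)).le ?_
  change (π.lTensor C ∘ₗ Coalgebra.comul).lTensor C (Coalgebra.comul x) =
    ((TensorProduct.mk R C M).flip m).lTensor C (Coalgebra.comul x)
  rw [lTensor_comul_assoc, mem_coinvariants.mp hx, LinearMap.rTensor_tmul, insert_comul]

/-- The left hit action `x ↦ x₍₁₎ f(x₍₂₎)` of a linear functional `f` on a coalgebra. -/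
def hit (f : C →ₗ[R] R) : C →ₗ[R] C :=
  (TensorProduct.rid R C).toLinearMap ∘ₗ f.lTensor C ∘ₗ Coalgebra.comul

theorem hit_add (f g : C →ₗ[R] R) (x : C) : hit (f + g) x = hit f x + hit g x := by
  simp [hit, LinearMap.lTensor_add]

theorem hit_smul (r : R) (f : C →ₗ[R] R) (x : C) : hit (r • f) x = r • hit f x := by
  simp [hit, LinearMap.lTensor_smul]

theorem hit_of_mem_coinvariants {π : C →ₗ[R] M} {m : M} (f : M →ₗ[R] R) {x : C}
    (hx : x ∈ coinvariants π m) : hit (f ∘ₗ π) x = f m • x := by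
  rw [hit, LinearMap.lTensor_comp, LinearMap.comp_apply, LinearMap.comp_apply,
    LinearMap.comp_apply, mem_coinvariants.mp hx]
  simp

end Coalgebra

section Bialgebra

variable {R A : Type*} [CommRing R] [Ring A] [Bialgebra R A]

theorem hit_one (f : A →ₗ[R] R) : hit f 1 = f 1 • 1 := by
  simp [hit, Algebra.TensorProduct.one_def]

theorem hit_matrix_mul {ι : Type*} [Fintype ι] {T : Matrix ι ι A}
    (hT : ∀ i j, Coalgebra.comul (R := R) (T i j) = ∑ k, T i k ⊗ₜ T k j) (f : A →ₗ[R] R) (i j : ι)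
    (x : A) : hit f (T i j * x) = ∑ k, T i k * hit (f ∘ₗ LinearMap.mulLeft R (T k j)) x := by
  suffices key : ∀ t : A ⊗[R] A, TensorProduct.rid R A (f.lTensor A ((∑ k, T i k ⊗ₜ T k j) * t)) =
      ∑ k, T i k * TensorProduct.rid R A ((f ∘ₗ LinearMap.mulLeft R (T k j)).lTensor A t) by
    simpa [hit, hT] using key (Coalgebra.comul x)
  intro t
  induction t with
  | zero => simp
  | add t u ht hu => simp only [mul_add, map_add, ht, hu, Finset.sum_add_distrib]
  | tmul y z => simp [Finset.sum_mul]

/-- The matrix `T B Tᵗ` of quadratic expressions in the entries of `T`, with the scalars of `B`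
written in front. -/
def congruence {ι : Type*} [Fintype ι] (T : Matrix ι ι A) (B : Matrix ι ι R) : Matrix ι ι A :=
  fun i j => ∑ k, ∑ l, B k l • (T i k * T j l)

theorem comul_congruence {ι : Type*} [Fintype ι] {T : Matrix ι ι A}
    (hT : ∀ i j, Coalgebra.comul (R := R) (T i j) = ∑ k, T i k ⊗ₜ T k j) (B : Matrix ι ι R)
    (i j : ι) : Coalgebra.comul (R := R) (congruence T B i j) =
      ∑ k, ∑ l, (T i k * T j l) ⊗ₜ congruence T B k l := by
  simp only [congruence, map_sum, map_smul, Bialgebra.comul_mul, hT, Finset.sum_mul_sum,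
    Algebra.TensorProduct.tmul_mul_tmul, Finset.smul_sum, TensorProduct.tmul_sum,
    TensorProduct.tmul_smul]
  calc _ = ∑ k, ∑ m, ∑ l, ∑ n, B k l • ((T i m * T j n) ⊗ₜ[R] (T m k * T n l)) :=
        Finset.sum_congr rfl fun _ _ => Finset.sum_comm
    _ = ∑ m, ∑ k, ∑ n, ∑ l, B k l • ((T i m * T j n) ⊗ₜ[R] (T m k * T n l)) := by
        rw [Finset.sum_comm]
        exact Finset.sum_congr rfl fun _ _ => Finset.sum_congr rfl fun _ _ => Finset.sum_comm
    _ = _ := Finset.sum_congr rfl fun _ _ => Finset.sum_comm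

theorem congruence_mem_coinvariants {ι M : Type*} [Fintype ι] [AddCommGroup M] [Module R M]
    {T : Matrix ι ι A}
    (hT : ∀ i j, Coalgebra.comul (R := R) (T i j) = ∑ k, T i k ⊗ₜ T k j) {B : Matrix ι ι R}
    {π : A →ₗ[R] M} (hπ : ∀ i j, π (congruence T B i j) = B i j • π 1) (i j : ι) :
    congruence T B i j ∈ coinvariants π (π 1) := by
  rw [mem_coinvariants, comul_congruence hT]
  simp only [map_sum, LinearMap.lTensor_tmul, hπ, TensorProduct.tmul_smul]
  simp only [congruence, TensorProduct.sum_tmul, TensorProduct.smul_tmul']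

theorem one_mem_coinvariants {M : Type*} [AddCommGroup M] [Module R M] (π : A →ₗ[R] M) :
    (1 : A) ∈ coinvariants π (π 1) := by
  simp [mem_coinvariants, Algebra.TensorProduct.one_def]

theorem mul_mem_coinvariants {I : Submodule R A} (hI : I * ⊤ ≤ I) {x y : A}
    (hx : x ∈ coinvariants I.mkQ (I.mkQ 1)) (hy : y ∈ coinvariants I.mkQ (I.mkQ 1)) :
    x * y ∈ coinvariants I.mkQ (I.mkQ 1) := by
  have stable (w : A) : I ≤ I.comap (LinearMap.mulRight R w) := fun v hv =>
    hI (Submodule.mul_mem_mul hv Submodule.mem_top)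
  have mul_right (t : A ⊗[R] A) (v w : A) : I.mkQ.lTensor A (t * (v ⊗ₜ w)) =
      TensorProduct.map (LinearMap.mulRight R v) (I.mapQ I (LinearMap.mulRight R w) (stable w))
        (I.mkQ.lTensor A t) := by
    induction t with
    | zero => simp
    | add t u ht hu => simp only [add_mul, map_add, ht, hu]
    | tmul p p' => simp
  have mul_left (t : A ⊗[R] A) : I.mkQ.lTensor A (Coalgebra.comul x * t) =
      (LinearMap.mulLeft R x).rTensor _ (I.mkQ.lTensor A t) := by
    induction t with
    | zero => simp
    | add t u ht hu => simp only [mul_add, map_add, ht, hu]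
    | tmul v w => simp [mul_right, mem_coinvariants.mp hx]
  rw [mem_coinvariants, Bialgebra.comul_mul, mul_left, mem_coinvariants.mp hy,
    LinearMap.rTensor_tmul, LinearMap.mulLeft_apply]

end Bialgebra

section Algebra

variable {R A : Type*} [CommSemiring R] [Semiring A] [Algebra R A]

theorem iSup_span_pow_eq_adjoin (s : Set A) :
    ⨆ n : ℕ, Submodule.span R s ^ n = Subalgebra.toSubmodule (Algebra.adjoin R s) := by
  refine le_antisymm (iSup_le fun n => ?_) fun x hx => ?_
  · refine (pow_le_pow_left' (Algebra.span_le_adjoin R s) n).trans ?_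
    induction n with
    | zero => simp [Submodule.one_le]
    | succ n ih =>
      rw [pow_succ]
      exact (mul_le_mul' ih le_rfl).trans (Subalgebra.isIdempotentElem_toSubmodule _).le
  · induction hx using Algebra.adjoin_induction with
    | mem x hx =>
      exact Submodule.mem_iSup_of_mem 1 (by simpa using Submodule.subset_span hx)
    | algebraMap r =>
      exact Submodule.mem_iSup_of_mem 0 (by simp)
    | add x y _ _ hx hy => exact add_mem hx hy
    | mul x y _ _ hx hy =>
      have h := Submodule.mul_mem_mul hx hy
      simp only [Submodule.iSup_mul, Submodule.mul_iSup, ← pow_add] at h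
      exact SetLike.le_def.mp (iSup₂_le fun n m =>
        le_iSup (Submodule.span R s ^ ·) (m + n)) h

theorem mul_pow_of_mul_eq_smul_mul {k : R} {x y : A} (h : x * y = k • (y * x)) (n : ℕ) :
    x * y ^ n = k ^ n • (y ^ n * x) := by
  induction n with
  | zero => simp
  | succ n ih =>
    rw [pow_succ, ← mul_assoc, ih, smul_mul_assoc, mul_assoc, h, mul_smul_comm, smul_smul,
      ← pow_succ, mul_assoc]

end Algebra

theorem eq_zero_of_mem_span_of_dual_eq_zero {K E ι : Type*} [Ring K] [NoZeroDivisors K]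
    [AddCommGroup E] [Module K E] {v : ι → E} {φ : ι → E →ₗ[K] K} (diag : ∀ k, φ k (v k) ≠ 0)
    (off_diag : ∀ k l, l ≠ k → φ k (v l) = 0) {x : E} (hx : x ∈ Submodule.span K (Set.range v))
    (h : ∀ k, φ k x = 0) : x = 0 := by
  obtain ⟨w, rfl⟩ := (Finsupp.mem_span_range_iff_exists_finsupp).mp hx
  have hw : w = 0 := by
    ext k
    have := h k
    rw [map_finsuppSum, Finsupp.sum, Finset.sum_eq_single k
      (fun l _ hl => by rw [map_smul, off_diag k l hl, smul_zero])
      (fun hk => by rw [Finsupp.notMem_support_iff.mp hk, zero_smul, map_zero]),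
      map_smul, smul_eq_mul] at this
    exact (mul_eq_zero.mp this).resolve_right (diag k)
  rw [hw, Finsupp.sum_zero_index]

end QuantumHomogeneous

namespace SLq

open QuantumHomogeneous

section Coinvariants

variable (q s : Circle) (μ ν : ℝ)

theorem mul_ab_assoc (x : Fun q) : a q * (b q * x) = (q : ℂ) • (b q * (a q * x)) := by
  rw [← mul_assoc, rel_ab, smul_mul_assoc, mul_assoc]

theorem mul_ac_assoc (x : Fun q) : a q * (c q * x) = (q : ℂ) • (c q * (a q * x)) := by
  rw [← mul_assoc, rel_ac, smul_mul_assoc, mul_assoc]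

theorem mul_cb_assoc (x : Fun q) : c q * (b q * x) = b q * (c q * x) := by
  rw [← mul_assoc, ← rel_bc, mul_assoc]

theorem mul_db_assoc (x : Fun q) : d q * (b q * x) = (q : ℂ)⁻¹ • (b q * (d q * x)) := by
  rw [← mul_assoc, mul_db, smul_mul_assoc, mul_assoc]

theorem mul_dc_assoc (x : Fun q) : d q * (c q * x) = (q : ℂ)⁻¹ • (c q * (d q * x)) := by
  rw [← mul_assoc, mul_dc, smul_mul_assoc, mul_assoc]

theorem mul_da_assoc (x : Fun q) :
    d q * (a q * x) = x + (q : ℂ)⁻¹ • (b q * (c q * x)) := by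
  rw [← mul_assoc, mul_da, add_mul, one_mul, smul_mul_assoc, mul_assoc]

theorem mul_ad_assoc (x : Fun q) :
    a q * (d q * x) = x + (q : ℂ) • (b q * (c q * x)) := by
  rw [← mul_assoc, mul_ad, add_mul, one_mul, smul_mul_assoc, mul_assoc]

variable {q s} (hs : s ^ 2 = q)

include hs in
theorem coe_eq_sq : (q : ℂ) = (s : ℂ) ^ 2 := by
  rw [← hs]; push_cast; rfl

include hs in
theorem z₁_mul_z₂ :
    z₁ q s μ ν * z₂ q s μ ν = ((q : ℂ) ^ 2) • (z₂ q s μ ν * z₁ q s μ ν) := by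
  have hq := coe_eq_sq hs
  have h0 : (s : ℂ) ≠ 0 := s.coe_ne_zero
  simp only [z₁, z₂, pow_two (c q), pow_two (d q), mul_add, add_mul, smul_add, smul_mul_assoc,
    mul_smul_comm, mul_assoc, mul_one, rel_ac, mul_dc, mul_da, mul_ad, mul_ac_assoc, mul_cb_assoc,
    mul_db_assoc, mul_dc_assoc, mul_ad_assoc, hq]
  match_scalars <;> field_simp

include hs in
theorem z₁_mul_z₃ :
    z₁ q s μ ν * z₃ q s μ ν = ((q : ℂ) ^ (-2 : ℤ)) • (z₃ q s μ ν * z₁ q s μ ν) := by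
  have hq := coe_eq_sq hs
  have h0 : (s : ℂ) ≠ 0 := s.coe_ne_zero
  simp only [z₁, z₃, pow_two (a q), pow_two (b q), mul_add, add_mul, smul_add, smul_mul_assoc,
    mul_smul_comm, mul_assoc, mul_one, rel_ab, rel_ac, ← rel_bc, mul_db, mul_da, mul_ad,
    mul_ab_assoc, mul_ac_assoc, mul_cb_assoc, mul_db_assoc, mul_da_assoc, hq]
  match_scalars <;> field_simp

include hs in
theorem z₃_mul_z₂ :
    z₃ q s μ ν * z₂ q s μ ν
      = algebraMap ℂ (Fun q) (ν : ℂ) + ((q : ℂ) ^ 2) • z₁ q s μ ν ^ 2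
        + (2 * μ * q : ℂ) • z₁ q s μ ν := by
  have hq := coe_eq_sq hs
  have h0 : (s : ℂ) ≠ 0 := s.coe_ne_zero
  simp only [Algebra.algebraMap_eq_smul_one, z₁, z₂, z₃, pow_two (a q), pow_two (b q),
    pow_two (c q), pow_two (d q), pow_two (_ + _), mul_add, add_mul, smul_add, smul_mul_assoc,
    mul_smul_comm, mul_assoc, mul_one, rel_ab, rel_ac, ← rel_bc, mul_dc, mul_da, mul_ad,
    mul_ab_assoc, mul_ac_assoc, mul_cb_assoc, mul_db_assoc, mul_dc_assoc,
    mul_ad_assoc, hq]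
  match_scalars <;> field_simp

include hs in
theorem isSelfAdjoint_z₁ : IsSelfAdjoint (z₁ q s μ ν) := by
  have hq := coe_eq_sq hs
  have h0 : (s : ℂ) ≠ 0 := s.coe_ne_zero
  simp only [IsSelfAdjoint, z₁, star_add, star_smul, star_mul, star_gen, Complex.star_def,
    map_inv₀, ← Circle.coe_inv_eq_conj, Circle.coe_inv,
    Complex.conj_ofReal, map_ofNat, mul_ca, mul_db, ← rel_bc, hq]
  match_scalars <;> field_simp

include hs in
theorem isSelfAdjoint_z₂ : IsSelfAdjoint (z₂ q s μ ν) := by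
  have hq := coe_eq_sq hs
  have h0 : (s : ℂ) ≠ 0 := s.coe_ne_zero
  simp only [IsSelfAdjoint, z₂, star_add, star_smul, star_mul, star_pow, star_gen,
    Complex.star_def, map_inv₀, ← Circle.coe_inv_eq_conj, Circle.coe_inv,
    Complex.conj_ofReal, map_ofNat, mul_dc, hq]
  match_scalars <;> field_simp

include hs in
theorem isSelfAdjoint_z₃ : IsSelfAdjoint (z₃ q s μ ν) := by
  have hq := coe_eq_sq hs
  have h0 : (s : ℂ) ≠ 0 := s.coe_ne_zero
  simp only [IsSelfAdjoint, z₃, star_add, star_smul, star_mul, star_pow, star_gen,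
    Complex.star_def, map_inv₀, ← Circle.coe_inv_eq_conj, Circle.coe_inv,
    Complex.conj_ofReal, map_ofNat, mul_ba, hq]
  match_scalars <;> field_simp

/-- The matrix `(a, b; c, d)` of generators. -/
def genMatrix (q : Circle) : Matrix (Fin 2) (Fin 2) (Fun q) := !![a q, b q; c q, d q]

/-- The matrix of the bilinear form fixed by the quantum subgroup: `z₁`, `z₂` and `z₃` are the
entries of its translate by `genMatrix`. -/
def formMatrix (s : Circle) (μ ν : ℝ) : Matrix (Fin 2) (Fin 2) ℂ := !![1, 2 * μ * s⁻¹; 0, ν]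

theorem comul_genMatrix (i j : Fin 2) : Coalgebra.comul (R := ℂ) (genMatrix q i j) =
    ∑ k, genMatrix q i k ⊗ₜ[ℂ] genMatrix q k j := by
  fin_cases i <;> fin_cases j <;>
    exact (comulHom_gen q _).trans (by simp [genMatrix, comulGen, Fin.sum_univ_two])

theorem congruence_genMatrix (i j : Fin 2) :
    congruence (genMatrix q) (formMatrix s μ ν) i j =
      genMatrix q i 0 * genMatrix q j 0 + (ν : ℂ) • (genMatrix q i 1 * genMatrix q j 1) +
        (2 * μ * s⁻¹ : ℂ) • (genMatrix q i 0 * genMatrix q j 1) := by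
  simp [congruence, formMatrix, add_right_comm]

theorem congruence_zero_zero : congruence (genMatrix q) (formMatrix s μ ν) 0 0 = z₃ q s μ ν := by
  rw [congruence_genMatrix, z₃, pow_two, pow_two]; rfl

theorem congruence_one_one : congruence (genMatrix q) (formMatrix s μ ν) 1 1 = z₂ q s μ ν := by
  rw [congruence_genMatrix, z₂, pow_two, pow_two]; rfl

include hs in
theorem congruence_one_zero :
    congruence (genMatrix q) (formMatrix s μ ν) 1 0 = (s⁻¹ : ℂ) • z₁ q s μ ν := by
  have hq := coe_eq_sq hs
  have h0 : (s : ℂ) ≠ 0 := s.coe_ne_zero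
  rw [congruence_genMatrix, z₁]
  change c q * a q + _ • (d q * b q) + _ • (c q * b q) = _
  rw [mul_ca, mul_db, ← rel_bc, hq]
  match_scalars <;> field_simp

include hs in
theorem congruence_zero_one : congruence (genMatrix q) (formMatrix s μ ν) 0 1 =
    (s : ℂ) • z₁ q s μ ν + (2 * μ * s⁻¹ : ℂ) • 1 := by
  have hq := coe_eq_sq hs
  have h0 : (s : ℂ) ≠ 0 := s.coe_ne_zero
  rw [congruence_genMatrix, z₁]
  change a q * c q + _ • (b q * d q) + _ • (a q * d q) = _
  rw [mul_ad, hq]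
  match_scalars <;> field_simp

theorem mul_mem_rightIdeal {x : Fun q} (hx : x ∈ coideal q s μ ν) (y : Fun q) :
    x * y ∈ rightIdeal q s μ ν :=
  Submodule.mul_mem_mul hx Submodule.mem_top

theorem fst_mul_mem_rightIdeal (y : Fun q) :
    (a q - d q + (2 * s * μ : ℂ) • b q) * y ∈ rightIdeal q s μ ν :=
  mul_mem_rightIdeal μ ν (Submodule.subset_span (by simp)) y

theorem snd_mul_mem_rightIdeal (y : Fun q) :
    ((q * ν : ℂ) • b q + c q) * y ∈ rightIdeal q s μ ν :=
  mul_mem_rightIdeal μ ν (Submodule.subset_span (by simp)) y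

include hs in
theorem proj_z₁ : proj q s μ ν (z₁ q s μ ν) = 0 := by
  have hq := coe_eq_sq hs
  have h0 : (s : ℂ) ≠ 0 := s.coe_ne_zero
  refine (Submodule.Quotient.mk_eq_zero _).mpr ?_
  convert add_mem ((rightIdeal q s μ ν).smul_mem (s : ℂ)⁻¹ (fst_mul_mem_rightIdeal μ ν (c q)))
    ((rightIdeal q s μ ν).smul_mem ((s : ℂ)⁻¹ * (q : ℂ)⁻¹) (snd_mul_mem_rightIdeal μ ν (d q)))
    using 1
  simp only [z₁, add_mul, sub_mul, smul_mul_assoc, mul_dc, hq]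
  match_scalars <;> field_simp
  ring

include hs in
theorem proj_z₂ : proj q s μ ν (z₂ q s μ ν) = (ν : ℂ) • proj q s μ ν 1 := by
  have hq := coe_eq_sq hs
  have h0 : (s : ℂ) ≠ 0 := s.coe_ne_zero
  rw [← map_smul]
  refine (Submodule.Quotient.eq _).mpr ?_
  convert add_mem (sub_mem (snd_mul_mem_rightIdeal μ ν (c q))
    ((rightIdeal q s μ ν).smul_mem (ν : ℂ) (fst_mul_mem_rightIdeal μ ν (d q))))
    ((rightIdeal q s μ ν).smul_mem (2 * μ * (s : ℂ)⁻¹) (snd_mul_mem_rightIdeal μ ν (d q)))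
    using 1
  simp only [z₂, add_mul, sub_mul, smul_mul_assoc, mul_ad, pow_two (c q), pow_two (d q), hq]
  match_scalars <;> field_simp <;> ring

include hs in
theorem proj_z₃ : proj q s μ ν (z₃ q s μ ν) = proj q s μ ν 1 := by
  have hq := coe_eq_sq hs
  have h0 : (s : ℂ) ≠ 0 := s.coe_ne_zero
  refine (Submodule.Quotient.eq _).mpr ?_
  convert add_mem (fst_mul_mem_rightIdeal μ ν (a q))
    ((rightIdeal q s μ ν).smul_mem ((q : ℂ)⁻¹) (snd_mul_mem_rightIdeal μ ν (b q)))
    using 1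
  simp only [z₃, add_mul, sub_mul, smul_mul_assoc, mul_da, mul_ba, ← rel_bc, pow_two (a q),
    pow_two (b q), hq]
  match_scalars <;> field_simp
  ring

include hs in
theorem proj_congruence (i j : Fin 2) :
    proj q s μ ν (congruence (genMatrix q) (formMatrix s μ ν) i j) =
      formMatrix s μ ν i j • proj q s μ ν 1 := by
  match i, j with
  | 0, 0 =>
    rw [congruence_zero_zero, proj_z₃ μ ν hs]
    simp [formMatrix]
  | 0, 1 =>
    rw [congruence_zero_one μ ν hs, map_add, map_smul, map_smul, proj_z₁ μ ν hs]
    simp [formMatrix]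
  | 1, 0 =>
    rw [congruence_one_zero μ ν hs, map_smul, proj_z₁ μ ν hs]
    simp [formMatrix]
  | 1, 1 =>
    rw [congruence_one_one, proj_z₂ μ ν hs]
    simp [formMatrix]

theorem homogeneousSpace_eq_coinvariants :
    homogeneousSpace q s μ ν = coinvariants (proj q s μ ν) (proj q s μ ν 1) := rfl

include hs in
theorem congruence_mem_homogeneousSpace (i j : Fin 2) :
    congruence (genMatrix q) (formMatrix s μ ν) i j ∈ homogeneousSpace q s μ ν :=
  congruence_mem_coinvariants comul_genMatrix (proj_congruence μ ν hs) i j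

end Coinvariants

section Filtration

variable (q : Circle)

theorem adjoin_range_gen : Algebra.adjoin ℂ (Set.range (gen q)) = ⊤ := by
  have hsurj : Function.Surjective (RingQuot.mkAlgHom ℂ (Rel (q : ℂ))) :=
    RingQuot.mkAlgHom_surjective ℂ _
  change Algebra.adjoin ℂ (Set.range (RingQuot.mkAlgHom ℂ (Rel (q : ℂ)) ∘ FreeAlgebra.ι ℂ)) = ⊤
  rw [Set.range_comp, ← AlgHom.map_adjoin, FreeAlgebra.adjoin_range_ι, Algebra.map_top]
  exact (AlgHom.range_eq_top _).mpr hsurj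

/-- The span of the products of at most `N` generators. -/
def degreeLE (N : ℕ) : Submodule ℂ (Fun q) :=
  Submodule.span ℂ (insert 1 (Set.range (gen q))) ^ N

theorem iSup_degreeLE : ⨆ N, degreeLE q N = ⊤ := by
  have : Algebra.adjoin ℂ (insert 1 (Set.range (gen q))) = ⊤ :=
    top_le_iff.mp ((adjoin_range_gen q).ge.trans (Algebra.adjoin_mono (Set.subset_insert _ _)))
  rw [← Algebra.top_toSubmodule, ← this, ← iSup_span_pow_eq_adjoin]
  rfl

variable {q}

theorem one_mem_degreeLE_zero : (1 : Fun q) ∈ degreeLE q 0 := by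
  rw [degreeLE, pow_zero]
  exact Submodule.one_le.mp le_rfl

theorem genMatrix_mem_range_gen (k l : Fin 2) : genMatrix q k l ∈ Set.range (gen q) :=
  match k, l with
  | 0, 0 => ⟨.a, rfl⟩
  | 0, 1 => ⟨.b, rfl⟩
  | 1, 0 => ⟨.c, rfl⟩
  | 1, 1 => ⟨.d, rfl⟩

theorem genMatrix_mul_mem_degreeLE (k l : Fin 2) {N : ℕ} {x : Fun q} (hx : x ∈ degreeLE q N) :
    genMatrix q k l * x ∈ degreeLE q (N + 1) := by
  rw [degreeLE, pow_succ']
  exact Submodule.mul_mem_mul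
    (Submodule.subset_span (Set.mem_insert_of_mem _ (genMatrix_mem_range_gen k l))) hx

theorem degreeLE_mono : Monotone (degreeLE q) :=
  pow_right_mono₀ (Submodule.one_le.mpr (Submodule.subset_span (Set.mem_insert _ _)))

theorem degreeLE_le_of_genMatrix_mul_mem {P : ℕ → Submodule ℂ (Fun q)} (one : 1 ∈ P 0)
    (succ : ∀ N, ∀ x ∈ degreeLE q N, x ∈ P N → x ∈ P (N + 1))
    (mul : ∀ N k l, ∀ x ∈ degreeLE q N, x ∈ P N → genMatrix q k l * x ∈ P (N + 1)) (N : ℕ) :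
    degreeLE q N ≤ P N := by
  induction N with
  | zero => simpa [degreeLE, Submodule.one_le] using one
  | succ N ih =>
    rw [degreeLE, pow_succ', Submodule.mul_le]
    intro u hu x hx
    refine (Submodule.span_le (p := (P (N + 1)).comap (LinearMap.mulRight ℂ x))).mpr ?_ hu
    rintro _ (rfl | ⟨g, rfl⟩)
    · simpa using succ N x hx (ih hx)
    · cases g
      · exact mul N 0 0 x hx (ih hx)
      · exact mul N 0 1 x hx (ih hx)
      · exact mul N 1 0 x hx (ih hx)
      · exact mul N 1 1 x hx (ih hx)

theorem eq_top_of_genMatrix_mul_mem {P : Submodule ℂ (Fun q)} (one : 1 ∈ P)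
    (mul : ∀ k l, ∀ x ∈ P, genMatrix q k l * x ∈ P) : P = ⊤ :=
  top_le_iff.mp ((iSup_degreeLE q).ge.trans (iSup_le
    (degreeLE_le_of_genMatrix_mul_mem (P := fun _ => P) one (fun _ _ _ hx => hx)
      fun _ k l x _ hx => mul k l x hx)))

theorem exists_mem_degreeLE (x : Fun q) : ∃ N, x ∈ degreeLE q N := by
  rw [← Submodule.mem_iSup_of_directed _ degreeLE_mono.directed_le, iSup_degreeLE]
  trivial

end Filtration

section Coefficients

variable (q : Circle)

namespace Gen

/-- The row of a generator in the matrix `(a, b; c, d)`. -/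
def row : Gen → Fin 2
  | .a => 0
  | .b => 0
  | .c => 1
  | .d => 1

/-- The column of a generator in the matrix `(a, b; c, d)`. -/
def col : Gen → Fin 2
  | .a => 0
  | .b => 1
  | .c => 0
  | .d => 1

end Gen

variable {q} in
theorem map_genMatrix {B : Type*} [Ring B] [Algebra ℂ B] {φ : Fun q →ₐ[ℂ] B}
    {M : Matrix (Fin 2) (Fin 2) B} (h : ∀ g : Gen, φ (gen q g) = M g.row g.col) (k l : Fin 2) :
    φ (genMatrix q k l) = M k l :=
  match k, l with
  | 0, 0 => h .a
  | 0, 1 => h .b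
  | 1, 0 => h .c
  | 1, 1 => h .d

/-- The operators by which the matrix `(a, b; c, d)` acts on functions on `ℤ³`. They come from
sending it to `(x ⊗ u, x ⊗ v; y ⊗ u, y ⊗ v + x⁻¹ ⊗ u⁻¹)` in a tensor product of two quantum tori;
the first variable of the functions records the degree, the other two the exponents of `y`
and `v`. -/
def opMatrix : Matrix (Fin 2) (Fin 2) (Module.End ℂ (ℤ → ℤ → ℤ → ℂ)) := fun k l =>
  { toFun f N i j := (q : ℂ) ^ (k * (i - N) + l * (j - N)) * f (N - 1) (i - k) (j - l) +
      k * l * f (N + 1) i j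
    map_add' f g := by
      funext N i j
      simp only [Pi.add_apply]
      ring
    map_smul' z f := by
      funext N i j
      simp only [Pi.smul_apply, smul_eq_mul, RingHom.id_apply]
      ring }

/-- The representation of the function algebra by the operators `opMatrix`. -/
def rep : Fun q →ₐ[ℂ] Module.End ℂ (ℤ → ℤ → ℤ → ℂ) := by
  have hq : (q : ℂ) ≠ 0 := q.coe_ne_zero
  refine lift (fun g => opMatrix q g.row g.col) ?_ ?_ ?_ ?_ ?_ ?_ ?_ <;>
  · refine LinearMap.ext fun f => ?_
    funext N i j
    simp only [opMatrix, Gen.row, Gen.col, Fin.coe_ofNat_eq_mod, Nat.zero_mod, Nat.mod_succ,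
      Nat.cast_zero, Nat.cast_one, mul_sub, mul_add, zero_mul, mul_zero, one_mul, mul_one, sub_self,
      sub_zero, zero_add, add_zero, sub_add_cancel, add_sub_cancel_right, zpow_sub₀ hq,
      zpow_add₀ hq, zpow_ofNat, pow_zero, pow_one, Module.End.mul_apply, Module.End.one_apply,
      LinearMap.sub_apply, LinearMap.smul_apply, LinearMap.coe_mk, AddHom.coe_mk, Pi.sub_apply,
      Pi.smul_apply, smul_eq_mul]
    field_simp
    try ring

/-- The coefficient of an element of the function algebra at a point of `ℤ³`, read off from its
action on the indicator function of the origin. -/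
def coef (N i j : ℤ) : Fun q →ₗ[ℂ] ℂ where
  toFun x := rep q x (fun N i j => if N = 0 ∧ i = 0 ∧ j = 0 then 1 else 0) N i j
  map_add' x y := by simp
  map_smul' z x := by simp

variable {q}

theorem coef_one (N i j : ℤ) : coef q N i j 1 = if N = 0 ∧ i = 0 ∧ j = 0 then 1 else 0 := by
  simp [coef]

theorem coef_genMatrix_mul (k l : Fin 2) (x : Fun q) (N i j : ℤ) :
    coef q N i j (genMatrix q k l * x) =
      (q : ℂ) ^ (k * (i - N) + l * (j - N)) * coef q (N - 1) (i - k) (j - l) x +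
        k * l * coef q (N + 1) i j x := by
  have h : rep q (genMatrix q k l) = opMatrix q k l :=
    map_genMatrix (φ := rep q) (fun g => by simp [rep]) k l
  simp [coef, h, opMatrix]

end Coefficients

section Symbols

variable {q : Circle}

theorem coef_eq_zero_of_neg {i j : ℤ} (h : i < 0 ∨ j < 0) (N : ℤ) (x : Fun q) :
    coef q N i j x = 0 := by
  let P : Submodule ℂ (Fun q) :=
    ⨅ (N : ℤ) (i : ℤ) (j : ℤ) (_ : i < 0 ∨ j < 0), LinearMap.ker (coef q N i j)
  have hP : P = ⊤ := by
    refine eq_top_of_genMatrix_mul_mem ?_ fun k l x hx => ?_ <;>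
      simp only [P, Submodule.mem_iInf, LinearMap.mem_ker] at *
    · intro N i j h
      rw [coef_one, if_neg (by omega)]
    · intro N i j h
      rw [coef_genMatrix_mul, hx _ (i - k) (j - l) (by omega), hx _ i j h, mul_zero, mul_zero,
        add_zero]
  have hx : x ∈ P := hP ▸ Submodule.mem_top
  simp only [P, Submodule.mem_iInf, LinearMap.mem_ker] at hx
  exact hx N i j h

theorem coef_eq_zero_of_lt {N : ℕ} {x : Fun q} (hx : x ∈ degreeLE q N) {n i : ℤ}
    (h : N < n ∨ N < i) (j : ℤ) : coef q n i j x = 0 := by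
  let P (N : ℕ) : Submodule ℂ (Fun q) :=
    ⨅ (n : ℤ) (i : ℤ) (j : ℤ) (_ : N < n ∨ N < i), LinearMap.ker (coef q n i j)
  have hP : degreeLE q N ≤ P N := by
    refine degreeLE_le_of_genMatrix_mul_mem ?_ (fun N x _ hx => ?_) (fun N k l x _ hx => ?_) N <;>
      simp only [P, Submodule.mem_iInf, LinearMap.mem_ker] at *
    · intro n i j h
      rw [coef_one, if_neg (by omega)]
    · exact fun n i j h => hx n i j (by omega)
    · intro n i j h
      rw [coef_genMatrix_mul, hx _ _ _ (by omega), hx _ _ _ (by omega), mul_zero, mul_zero,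
        add_zero]
  have := hP hx
  simp only [P, Submodule.mem_iInf, LinearMap.mem_ker] at this
  exact this n i j h

theorem coef_succ_genMatrix_mul (k l : Fin 2) {N : ℕ} {x : Fun q} (hx : x ∈ degreeLE q N)
    (i j : ℤ) : coef q (N + 1) i j (genMatrix q k l * x) =
      (q : ℂ) ^ (k * (i - (N + 1)) + l * (j - (N + 1)) : ℤ) * coef q N (i - k) (j - l) x := by
  rw [coef_genMatrix_mul, coef_eq_zero_of_lt hx (n := N + 1 + 1) (.inl (by omega)), mul_zero,
    add_zero, add_sub_cancel_right]

/-- The leading symbol of an element `x` of degree at most `N`, that is the family of the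
coefficients `coef q N i j x`, is concentrated in a single position `(i, j)`. -/
structure HasPureSymbol (N : ℕ) (i j : ℤ) (x : Fun q) : Prop where
  mem_degreeLE : x ∈ degreeLE q N
  coef_ne_zero : coef q N i j x ≠ 0
  coef_eq_zero : ∀ i' j', (i' ≠ i ∨ j' ≠ j) → coef q N i' j' x = 0

theorem hasPureSymbol_one : HasPureSymbol 0 0 0 (1 : Fun q) where
  mem_degreeLE := one_mem_degreeLE_zero
  coef_ne_zero := by simp [coef_one]
  coef_eq_zero i j h := by
    rw [coef_one, if_neg (by omega)]

theorem HasPureSymbol.genMatrix_mul {N : ℕ} {i j : ℤ} {x : Fun q} (hx : HasPureSymbol N i j x)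
    (k l : Fin 2) : HasPureSymbol (N + 1) (i + k) (j + l) (genMatrix q k l * x) where
  mem_degreeLE := genMatrix_mul_mem_degreeLE k l hx.mem_degreeLE
  coef_ne_zero := by
    rw [Nat.cast_succ, coef_succ_genMatrix_mul k l hx.mem_degreeLE, add_sub_cancel_right,
      add_sub_cancel_right]
    exact mul_ne_zero (zpow_ne_zero _ q.coe_ne_zero) hx.coef_ne_zero
  coef_eq_zero i' j' h := by
    rw [Nat.cast_succ, coef_succ_genMatrix_mul k l hx.mem_degreeLE,
      hx.coef_eq_zero _ _ (by omega), mul_zero]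

theorem HasPureSymbol.genMatrix_pow_mul {N : ℕ} {i j : ℤ} {x : Fun q}
    (hx : HasPureSymbol N i j x) (k l : Fin 2) (n : ℕ) :
    HasPureSymbol (N + n) (i + n * k) (j + n * l) (genMatrix q k l ^ n * x) := by
  induction n with
  | zero => simpa using hx
  | succ n ih =>
    rw [pow_succ', mul_assoc]
    convert ih.genMatrix_mul k l using 1 <;> push_cast <;> ring

end Symbols

section NormalMonomials

variable (q : Circle)

/-- The monomial `a ^ p` for `p ≥ 0` and `d ^ (-p)` for `p ≤ 0`. -/
def adPow (p : ℤ) : Fun q := a q ^ p.toNat * d q ^ (-p).toNat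

/-- The Poincaré–Birkhoff–Witt monomials `b ^ r * c ^ t * a ^ p` and `b ^ r * c ^ t * d ^ (-p)`. -/
def normalMonomial : ℕ × ℕ × ℤ → Fun q :=
  fun (r, t, p) => b q ^ r * (c q ^ t * adPow q p)

/-- The number of generators in a normal monomial. -/
def normalDegree : ℕ × ℕ × ℤ → ℕ :=
  fun (r, t, p) => r + t + p.natAbs

variable {q}

theorem a_mul_adPow_of_nonneg {p : ℤ} (hp : 0 ≤ p) : a q * adPow q p = adPow q (p + 1) := by
  lift p to ℕ using hp
  rw [adPow, adPow, ← mul_assoc, ← pow_succ', show (-(p + 1 : ℤ)).toNat = 0 by omega]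
  simp

theorem d_mul_adPow_of_nonpos {p : ℤ} (hp : p ≤ 0) : d q * adPow q p = adPow q (p - 1) := by
  obtain ⟨n, rfl⟩ := Int.exists_eq_neg_ofNat hp
  simp only [adPow]
  rw [show (-(n : ℤ)).toNat = 0 by omega, show (-(n : ℤ) - 1).toNat = 0 by omega,
    show (-(-(n : ℤ) - 1)).toNat = n + 1 by omega, pow_succ']
  simp

theorem a_mul_adPow_of_neg {p : ℤ} (hp : p < 0) :
    a q * adPow q p = adPow q (p + 1) + (q : ℂ) • (b q * (c q * adPow q (p + 1))) := by
  rw [← mul_ad_assoc, d_mul_adPow_of_nonpos (by omega), add_sub_cancel_right]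

theorem d_mul_adPow_of_pos {p : ℤ} (hp : 0 < p) :
    d q * adPow q p = adPow q (p - 1) + (q : ℂ)⁻¹ • (b q * (c q * adPow q (p - 1))) := by
  rw [← mul_da_assoc, a_mul_adPow_of_nonneg (by omega), sub_add_cancel]

theorem hasPureSymbol_normalMonomial (r t : ℕ) (p : ℤ) :
    HasPureSymbol (normalDegree (r, t, p)) (t + (-p).toNat) (r + (-p).toNat)
      (normalMonomial q (r, t, p)) := by
  have h := ((((hasPureSymbol_one (q := q)).genMatrix_pow_mul 1 1 (-p).toNat).genMatrix_pow_mul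
    0 0 p.toNat).genMatrix_pow_mul 1 0 t).genMatrix_pow_mul 0 1 r
  convert h using 1
  · simp only [normalDegree]
    omega
  · simp [add_comm]
  · simp [add_comm]
  · simp [normalMonomial, adPow, genMatrix]

/-- The span of the normal monomials in at most `N` generators. -/
def normalLE (q : Circle) (N : ℕ) : Submodule ℂ (Fun q) :=
  Submodule.span ℂ (normalMonomial q '' {k | normalDegree k ≤ N})

theorem normalMonomial_mem_normalLE {r t N : ℕ} {p : ℤ} (h : r + t + p.natAbs ≤ N) :
    b q ^ r * (c q ^ t * adPow q p) ∈ normalLE q N :=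
  Submodule.subset_span ⟨(r, t, p), h, rfl⟩

theorem mul_normalMonomial {e : Fun q} {k : ℂ} (hb : e * b q = k • (b q * e))
    (hc : e * c q = k • (c q * e)) (r t : ℕ) (w : Fun q) :
    e * (b q ^ r * (c q ^ t * w)) = k ^ (r + t) • (b q ^ r * (c q ^ t * (e * w))) := by
  rw [← mul_assoc, mul_pow_of_mul_eq_smul_mul hb, smul_mul_assoc, mul_assoc, ← mul_assoc e,
    mul_pow_of_mul_eq_smul_mul hc, smul_mul_assoc, mul_assoc, mul_smul_comm, smul_smul, pow_add]

theorem c_mul_normalMonomial (r t : ℕ) (w : Fun q) :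
    c q * (b q ^ r * (c q ^ t * w)) = b q ^ r * (c q ^ (t + 1) * w) := by
  rw [← mul_assoc, (show Commute (c q) (b q) from (rel_bc q).symm).pow_right r |>.eq, mul_assoc,
    ← mul_assoc (c q), ← pow_succ']

theorem normalMonomial_mul_bc (r t : ℕ) (w : Fun q) :
    b q ^ r * (c q ^ t * (b q * (c q * w))) = b q ^ (r + 1) * (c q ^ (t + 1) * w) := by
  rw [← mul_assoc (c q ^ t), ← (show Commute (b q) (c q) from rel_bc q).pow_right t |>.eq,
    mul_assoc (b q), ← mul_assoc (b q ^ r), ← pow_succ, ← mul_assoc (c q ^ t), ← pow_succ]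

theorem genMatrix_mul_normalMonomial_mem {r t N : ℕ} {p : ℤ} (h : r + t + p.natAbs ≤ N)
    (k l : Fin 2) : genMatrix q k l * (b q ^ r * (c q ^ t * adPow q p)) ∈ normalLE q (N + 1) := by
  match k, l with
  | 0, 0 =>
    change a q * _ ∈ _
    rw [mul_normalMonomial (rel_ab q) (rel_ac q)]
    refine Submodule.smul_mem _ _ ?_
    rcases le_or_gt 0 p with hp | hp
    · rw [a_mul_adPow_of_nonneg hp]
      exact normalMonomial_mem_normalLE (by omega)
    · rw [a_mul_adPow_of_neg hp]
      simp only [mul_add, mul_smul_comm, normalMonomial_mul_bc]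
      exact add_mem (normalMonomial_mem_normalLE (by omega))
        (Submodule.smul_mem _ _ (normalMonomial_mem_normalLE (by omega)))
  | 0, 1 =>
    change b q * _ ∈ _
    rw [← mul_assoc, ← pow_succ']
    exact normalMonomial_mem_normalLE (by omega)
  | 1, 0 =>
    change c q * _ ∈ _
    rw [c_mul_normalMonomial]
    exact normalMonomial_mem_normalLE (by omega)
  | 1, 1 =>
    change d q * _ ∈ _
    rw [mul_normalMonomial (mul_db q) (mul_dc q)]
    refine Submodule.smul_mem _ _ ?_
    rcases le_or_gt p 0 with hp | hp
    · rw [d_mul_adPow_of_nonpos hp]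
      exact normalMonomial_mem_normalLE (by omega)
    · rw [d_mul_adPow_of_pos hp]
      simp only [mul_add, mul_smul_comm, normalMonomial_mul_bc]
      exact add_mem (normalMonomial_mem_normalLE (by omega))
        (Submodule.smul_mem _ _ (normalMonomial_mem_normalLE (by omega)))

theorem degreeLE_le_normalLE (N : ℕ) : degreeLE q N ≤ normalLE q N := by
  refine degreeLE_le_of_genMatrix_mul_mem ?_ (fun N x _ hx => ?_) (fun N k l x _ hx => ?_) N
  · simpa [adPow] using normalMonomial_mem_normalLE (q := q) (r := 0) (t := 0) (p := 0) le_rfl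
  · exact Submodule.span_mono (Set.image_mono fun k hk => Nat.le_succ_of_le hk) hx
  · refine (Submodule.span_le (p := (normalLE q (N + 1)).comap
      (LinearMap.mulLeft ℂ (genMatrix q k l)))).mpr ?_ hx
    rintro _ ⟨⟨r, t, p⟩, h, rfl⟩
    exact genMatrix_mul_normalMonomial_mem h k l

theorem mem_degreeLE_of_coef_eq_zero {N : ℕ} {x : Fun q} (hx : x ∈ degreeLE q (N + 1))
    (h : ∀ i j, coef q (N + 1) i j x = 0) : x ∈ degreeLE q N := by
  let top (k : {k // normalDegree k = N + 1}) : Fun q := normalMonomial q k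
  have le_sup : normalLE q (N + 1) ≤ Submodule.span ℂ (Set.range top) ⊔ degreeLE q N := by
    refine Submodule.span_le.mpr ?_
    rintro _ ⟨k, (hk : normalDegree k ≤ N + 1), rfl⟩
    rcases eq_or_lt_of_le hk with hk | hk
    · exact Submodule.mem_sup_left (Submodule.subset_span ⟨⟨k, hk⟩, rfl⟩)
    · exact Submodule.mem_sup_right (degreeLE_mono (Nat.le_of_lt_succ hk)
        (hasPureSymbol_normalMonomial k.1 k.2.1 k.2.2).mem_degreeLE)
  obtain ⟨y, hy, z, hz, rfl⟩ := Submodule.mem_sup.mp (le_sup (degreeLE_le_normalLE _ hx))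
  suffices y = 0 by simpa [this] using hz
  have pure_symbol (k : {k // normalDegree k = N + 1}) :
      HasPureSymbol (N + 1) (k.1.2.1 + (-k.1.2.2).toNat) (k.1.1 + (-k.1.2.2).toNat) (top k) := by
    have := hasPureSymbol_normalMonomial (q := q) k.1.1 k.1.2.1 k.1.2.2
    rwa [k.2] at this
  refine eq_zero_of_mem_span_of_dual_eq_zero (fun k => (pure_symbol k).coef_ne_zero)
    (fun k l hkl => (pure_symbol l).coef_eq_zero _ _ ?_) hy fun k => ?_
  · obtain ⟨⟨r, t, p⟩, hk⟩ := k
    obtain ⟨⟨r', t', p'⟩, hl⟩ := l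
    rw [ne_eq, Subtype.mk_eq_mk, Prod.mk.injEq, Prod.mk.injEq] at hkl
    simp only [normalDegree] at hk hl ⊢
    omega
  · have := h (k.1.2.1 + (-k.1.2.2).toNat) (k.1.1 + (-k.1.2.2).toNat)
    rw [map_add, coef_eq_zero_of_lt hz (.inl (by omega)), add_zero] at this
    exact_mod_cast this

end NormalMonomials

section Functionals

variable {q : Circle}

theorem hit_mem_degreeLE (f : Fun q →ₗ[ℂ] ℂ) {N : ℕ} {x : Fun q} (hx : x ∈ degreeLE q N) :
    hit f x ∈ degreeLE q N := by
  let P (N : ℕ) : Submodule ℂ (Fun q) := ⨅ f : Fun q →ₗ[ℂ] ℂ, (degreeLE q N).comap (hit f)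
  have hP : degreeLE q N ≤ P N := by
    refine degreeLE_le_of_genMatrix_mul_mem ?_ (fun N x _ hx => ?_) (fun N k l x _ hx => ?_) N <;>
      simp only [P, Submodule.mem_iInf, Submodule.mem_comap] at *
    · intro f
      rw [hit_one]
      exact Submodule.smul_mem _ _ one_mem_degreeLE_zero
    · exact fun f => degreeLE_mono N.le_succ (hx f)
    · intro f
      rw [hit_matrix_mul comul_genMatrix]
      exact sum_mem fun m _ => genMatrix_mul_mem_degreeLE k m (hx _)
  have := hP hx
  simp only [P, Submodule.mem_iInf, Submodule.mem_comap] at this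
  exact this f

theorem rightIdeal_le_ker {s : Circle} {μ ν : ℝ} {f : Fun q →ₗ[ℂ] ℂ}
    (fst : ∀ y, f ((a q - d q + (2 * s * μ : ℂ) • b q) * y) = 0)
    (snd : ∀ y, f (((q * ν : ℂ) • b q + c q) * y) = 0) :
    rightIdeal q s μ ν ≤ LinearMap.ker f := by
  refine Submodule.mul_le.mpr fun u hu y _ => ?_
  refine (Submodule.span_le (p := (LinearMap.ker f).comap (LinearMap.mulRight ℂ y))).mpr ?_ hu
  rintro _ (rfl | rfl)
  exacts [fst y, snd y]

theorem hit_of_mem_homogeneousSpace {s : Circle} {μ ν : ℝ} {f : Fun q →ₗ[ℂ] ℂ}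
    (hf : rightIdeal q s μ ν ≤ LinearMap.ker f) {x : Fun q} (hx : x ∈ homogeneousSpace q s μ ν) :
    hit f x = f 1 • x := by
  rw [homogeneousSpace_eq_coinvariants] at hx
  have := hit_of_mem_coinvariants ((rightIdeal q s μ ν).liftQ f hf) hx
  rwa [proj, Submodule.liftQ_mkQ, Submodule.mkQ_apply, Submodule.liftQ_apply] at this

/-- The character of the function algebra given by the diagonal matrix with entries `u`, `u⁻¹`. -/
def diagChar (q : Circle) (u : ℂˣ) : Fun q →ₐ[ℂ] ℂ :=
  lift (fun g => (!![(u : ℂ), 0; 0, (u⁻¹ : ℂˣ)] : Matrix (Fin 2) (Fin 2) ℂ) g.row g.col)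
    (by simp [Gen.row, Gen.col]) (by simp [Gen.row, Gen.col]) (by simp [Gen.row, Gen.col])
    (by simp [Gen.row, Gen.col]) (by simp [Gen.row, Gen.col]) (by simp [Gen.row, Gen.col])
    (by simp [Gen.row, Gen.col])

theorem diagChar_genMatrix (u : ℂˣ) (k l : Fin 2) : diagChar q u (genMatrix q k l) =
    (!![(u : ℂ), 0; 0, (u⁻¹ : ℂˣ)] : Matrix (Fin 2) (Fin 2) ℂ) k l :=
  map_genMatrix (fun g => by simp [diagChar]) k l

theorem hit_diagChar_genMatrix_mul (u : ℂˣ) (k l : Fin 2) (x : Fun q) :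
    hit (diagChar q u).toLinearMap (genMatrix q k l * x) =
      (u : ℂ) ^ (1 - 2 * l : ℤ) • (genMatrix q k l * hit (diagChar q u).toLinearMap x) := by
  have (m : Fin 2) : (diagChar q u).toLinearMap ∘ₗ LinearMap.mulLeft ℂ (genMatrix q m l) =
      diagChar q u (genMatrix q m l) • (diagChar q u).toLinearMap := by
    ext x
    simp
  simp only [hit_matrix_mul comul_genMatrix, this, hit_smul, diagChar_genMatrix,
    Fin.sum_univ_two, mul_smul_comm]
  fin_cases l <;> simp

theorem coef_hit_diagChar (u : ℂˣ) (N i j : ℤ) (x : Fun q) :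
    coef q N i j (hit (diagChar q u).toLinearMap x) = (u : ℂ) ^ (N - 2 * j) * coef q N i j x := by
  have hu := u.ne_zero
  let P : Submodule ℂ (Fun q) := ⨅ (N : ℤ) (i : ℤ) (j : ℤ), LinearMap.eqLocus
    (coef q N i j ∘ₗ hit (diagChar q u).toLinearMap) ((u : ℂ) ^ (N - 2 * j) • coef q N i j)
  have hP : P = ⊤ := by
    refine eq_top_of_genMatrix_mul_mem ?_ fun k l x hx => ?_ <;>
      simp only [P, Submodule.mem_iInf, LinearMap.mem_eqLocus, LinearMap.comp_apply,
        LinearMap.smul_apply, smul_eq_mul] at *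
    · intro N i j
      rw [hit_one, map_smul, coef_one]
      split_ifs with h
      · simp [h.1, h.2.2]
      · simp
    · intro N i j
      rw [hit_diagChar_genMatrix_mul, map_smul, coef_genMatrix_mul, coef_genMatrix_mul, hx, hx]
      fin_cases l <;>
      · simp only [Nat.cast_zero, Nat.cast_one, mul_zero, mul_one, zero_mul, one_mul, sub_self,
          sub_zero, add_zero, mul_add, mul_sub, zpow_add₀ hu, zpow_sub₀ hu, zpow_ofNat,
          smul_eq_mul]
        field_simp
  have hx : x ∈ P := hP ▸ Submodule.mem_top
  simp only [P, Submodule.mem_iInf, LinearMap.mem_eqLocus] at hx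
  exact hx N i j

theorem rightIdeal_le_ker_diagChar (s : Circle) (μ ν : ℝ) :
    rightIdeal q s μ ν ≤ LinearMap.ker (diagChar q (-1)).toLinearMap :=
  rightIdeal_le_ker (fun y => by simp [diagChar, Gen.row, Gen.col])
    (fun y => by simp [diagChar, Gen.row, Gen.col])

end Functionals

section SkewDerivation

variable (q s : Circle) (μ ν : ℝ)

/-- The values on the matrix `(a, b; c, d)` of the representation of the function algebra by upper
triangular matrices with diagonal entries the counit and `diagChar q q⁻¹`; it is chosen such that
the elements of the coideal go to matrices with vanishing first row. -/
def triMatrix : Matrix (Fin 2) (Fin 2) (Matrix (Fin 2) (Fin 2) ℂ) :=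
  !![!![1, -2 * s * μ * (q - 1); 0, (q : ℂ)⁻¹], !![0, q ^ 2 - 1; 0, 0];
    !![0, -q * ν * (q ^ 2 - 1); 0, 0], !![1, 2 * s * q * μ * (q - 1); 0, q]]

/-- The representation by upper triangular matrices with the values `triMatrix` on generators. -/
def triHom : Fun q →ₐ[ℂ] Matrix (Fin 2) (Fin 2) ℂ := by
  have hq : (q : ℂ) ≠ 0 := q.coe_ne_zero
  refine lift (fun g => triMatrix q s μ ν g.row g.col) ?_ ?_ ?_ ?_ ?_ ?_ ?_ <;>
  · ext i j
    simp only [triMatrix, Gen.row, Gen.col, Matrix.of_apply, Matrix.cons_val, Matrix.mul_apply,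
      Matrix.smul_apply, Matrix.sub_apply, Matrix.one_fin_two, Fin.sum_univ_two, smul_eq_mul]
    fin_cases i <;> fin_cases j <;> simp only [Fin.zero_eta, Fin.mk_one, Matrix.cons_val] <;>
      field_simp <;> ring

/-- The functional `Y` given by the upper right corner of `triHom`. It is twisted primitive, that
is `Y (x * y) = ε x * Y y + Y x * χ y` for the counit `ε` and the character
`χ = diagChar q q⁻¹`. -/
def twistedPrimitive : Fun q →ₗ[ℂ] ℂ :=
  Matrix.entryLinearMap ℂ ℂ 0 1 ∘ₗ (triHom q s μ ν).toLinearMap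

variable {q s μ ν}

theorem triHom_genMatrix (k l : Fin 2) :
    triHom q s μ ν (genMatrix q k l) = triMatrix q s μ ν k l :=
  map_genMatrix (fun g => by simp [triHom]) k l

theorem triHom_second_row (x : Fun q) : triHom q s μ ν x 1 0 = 0 ∧
    triHom q s μ ν x 1 1 = diagChar q (Circle.toUnits q⁻¹) x := by
  let P : Submodule ℂ (Fun q) :=
    LinearMap.ker (Matrix.entryLinearMap ℂ ℂ 1 0 ∘ₗ (triHom q s μ ν).toLinearMap) ⊓
      LinearMap.eqLocus (Matrix.entryLinearMap ℂ ℂ 1 1 ∘ₗ (triHom q s μ ν).toLinearMap)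
        (diagChar q (Circle.toUnits q⁻¹)).toLinearMap
  have hP : P = ⊤ := by
    refine eq_top_of_genMatrix_mul_mem ⟨by simp, by simp⟩ fun k l x hx => ?_
    simp only [P, Submodule.mem_inf, LinearMap.mem_ker, LinearMap.mem_eqLocus,
      LinearMap.comp_apply, AlgHom.toLinearMap_apply, Matrix.entryLinearMap_apply, map_mul,
      Matrix.mul_apply, Fin.sum_univ_two, triHom_genMatrix, diagChar_genMatrix] at *
    rw [hx.1, hx.2]
    fin_cases k <;> fin_cases l <;> simp [triMatrix]
  have hx : x ∈ P := hP ▸ Submodule.mem_top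
  exact hx

theorem twistedPrimitive_genMatrix_mul (k l : Fin 2) (x : Fun q) :
    twistedPrimitive q s μ ν (genMatrix q k l * x) =
      (1 : Matrix (Fin 2) (Fin 2) ℂ) k l * twistedPrimitive q s μ ν x +
        triMatrix q s μ ν k l 0 1 * diagChar q (Circle.toUnits q⁻¹) x := by
  simp only [twistedPrimitive, LinearMap.comp_apply, AlgHom.toLinearMap_apply, map_mul,
    Matrix.entryLinearMap_apply, Matrix.mul_apply, Fin.sum_univ_two, triHom_genMatrix,
    (triHom_second_row x).2]
  fin_cases k <;> fin_cases l <;> simp [triMatrix]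

theorem twistedPrimitive_mul_eq_zero {u : Fun q} (hu : triHom q s μ ν u 0 = 0) (y : Fun q) :
    twistedPrimitive q s μ ν (u * y) = 0 := by
  simp [twistedPrimitive, Matrix.mul_apply, hu]

theorem rightIdeal_le_ker_twistedPrimitive :
    rightIdeal q s μ ν ≤ LinearMap.ker (twistedPrimitive q s μ ν) := by
  refine rightIdeal_le_ker (twistedPrimitive_mul_eq_zero ?_) (twistedPrimitive_mul_eq_zero ?_) <;>
  · ext j
    fin_cases j <;>
    · simp only [map_add, map_sub, map_smul, triHom, lift_gen, triMatrix, Gen.row, Gen.col,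
        Matrix.add_apply, Matrix.sub_apply, Matrix.smul_apply, Matrix.of_apply, Matrix.cons_val,
        Fin.zero_eta, Fin.mk_one, Pi.zero_apply, smul_eq_mul]
      ring

/-- The skew derivation attached to the twisted primitive functional: it satisfies
`D (x * y) = x * D y + D x * σ y` for the automorphism `σ = hit (diagChar q q⁻¹)`. -/
def skewDer (q s : Circle) (μ ν : ℝ) : Fun q →ₗ[ℂ] Fun q := hit (twistedPrimitive q s μ ν)

theorem skewDer_of_mem_homogeneousSpace {x : Fun q} (hx : x ∈ homogeneousSpace q s μ ν) :
    skewDer q s μ ν x = 0 := by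
  rw [skewDer, hit_of_mem_homogeneousSpace rightIdeal_le_ker_twistedPrimitive hx]
  simp [twistedPrimitive]

theorem skewDer_genMatrix_mul (k l : Fin 2) (x : Fun q) :
    skewDer q s μ ν (genMatrix q k l * x) = genMatrix q k l * skewDer q s μ ν x +
      ∑ m, triMatrix q s μ ν m l 0 1 •
        (genMatrix q k m * hit (diagChar q (Circle.toUnits q⁻¹)).toLinearMap x) := by
  have (m : Fin 2) : twistedPrimitive q s μ ν ∘ₗ LinearMap.mulLeft ℂ (genMatrix q m l) =
      (1 : Matrix (Fin 2) (Fin 2) ℂ) m l • twistedPrimitive q s μ ν +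
        triMatrix q s μ ν m l 0 1 • (diagChar q (Circle.toUnits q⁻¹)).toLinearMap := by
    ext x
    simp [twistedPrimitive_genMatrix_mul]
  simp only [skewDer, hit_matrix_mul comul_genMatrix, this, hit_add, hit_smul, mul_add,
    mul_smul_comm, Finset.sum_add_distrib]
  simp [Matrix.one_apply]

theorem skewDer_one : skewDer q s μ ν 1 = 0 := by
  simp [skewDer, hit_one, twistedPrimitive]

theorem skewDer_mem_degreeLE {N : ℕ} {x : Fun q} (hx : x ∈ degreeLE q N) :
    skewDer q s μ ν x ∈ degreeLE q N :=
  hit_mem_degreeLE _ hx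

variable (q s μ ν) in
/-- The coefficient of `skewDer q s μ ν x` at `(N, i, j)` for `x` of degree at most `N`: the skew
derivation acts on leading symbols by a tridiagonal matrix in the variable `j`. -/
def leadingSkewDer (N i j : ℤ) : Fun q →ₗ[ℂ] ℂ :=
  (q * ((q : ℂ) ^ (j + 1) - (q : ℂ) ^ (-(j + 1))) : ℂ) • coef q N i (j + 1)
    + (2 * s * μ * q * ((q : ℂ) ^ (2 * j - N) - 1) : ℂ) • coef q N i j
    - (ν * (q : ℂ) ^ (j + 2) * (1 - (q : ℂ) ^ (-2 * (N - j + 1))) : ℂ) • coef q N i (j - 1)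

theorem leadingSkewDer_one (i j : ℤ) : leadingSkewDer q s μ ν 0 i j 1 = 0 := by
  simp only [leadingSkewDer, LinearMap.add_apply, LinearMap.sub_apply, LinearMap.smul_apply,
    coef_one]
  by_cases h : j ∈ ({-1, 0, 1} : Set ℤ)
  · rcases h with rfl | rfl | rfl <;> simp
  · simp only [Set.mem_insert_iff, Set.mem_singleton_iff] at h
    rw [if_neg (by omega), if_neg (by omega), if_neg (by omega)]
    simp

theorem coef_skewDer_genMatrix_mul (k l : Fin 2) {N : ℕ} {x : Fun q} (hx : x ∈ degreeLE q N)
    (h : ∀ i j, coef q N i j (skewDer q s μ ν x) = leadingSkewDer q s μ ν N i j x) (i j : ℤ) :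
    coef q (N + 1) i j (skewDer q s μ ν (genMatrix q k l * x)) =
      leadingSkewDer q s μ ν (N + 1) i j (genMatrix q k l * x) := by
  have hq : (q : ℂ) ≠ 0 := q.coe_ne_zero
  simp only [skewDer_genMatrix_mul, map_add, map_smul, smul_eq_mul, Fin.sum_univ_two, h,
    leadingSkewDer, LinearMap.add_apply, LinearMap.sub_apply, LinearMap.smul_apply,
    coef_succ_genMatrix_mul _ _ hx, coef_succ_genMatrix_mul _ _ (skewDer_mem_degreeLE hx),
    coef_succ_genMatrix_mul _ _ (hit_mem_degreeLE _ hx), coef_hit_diagChar]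
  simp only [zpow_add₀ hq (k * (i - (N + 1)) : ℤ)]
  generalize (q : ℂ) ^ (k * (i - (N + 1)) : ℤ) = E
  fin_cases l <;>
  · simp only [triMatrix, Matrix.of_apply, Matrix.cons_val, Circle.toUnits_apply, Units.val_mk0,
      Circle.coe_inv, inv_zpow', Fin.zero_eta, Fin.mk_one, Fin.coe_ofNat_eq_mod, Nat.zero_mod,
      Nat.mod_succ, Nat.cast_zero, Nat.cast_one, zero_mul, one_mul, sub_zero, sub_add_cancel,
      add_sub_cancel_right, neg_add, neg_mul, mul_add, mul_sub, zpow_neg, zpow_sub₀ hq,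
      zpow_add₀ hq, zpow_mul', zpow_ofNat]
    field_simp
    ring

theorem coef_skewDer {N : ℕ} {x : Fun q} (hx : x ∈ degreeLE q N) (i j : ℤ) :
    coef q N i j (skewDer q s μ ν x) = leadingSkewDer q s μ ν N i j x := by
  let P (N : ℕ) : Submodule ℂ (Fun q) := ⨅ (i : ℤ) (j : ℤ),
    LinearMap.eqLocus (coef q N i j ∘ₗ skewDer q s μ ν) (leadingSkewDer q s μ ν N i j)
  suffices hP : degreeLE q N ≤ P N by
    have := hP hx
    simp only [P, Submodule.mem_iInf] at this
    exact this i j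
  refine degreeLE_le_of_genMatrix_mul_mem ?_ (fun N x hxN hx => ?_) (fun N k l x hxN hx => ?_) N <;>
    simp only [P, Submodule.mem_iInf, LinearMap.mem_eqLocus, LinearMap.comp_apply] at * <;>
    intro i j
  · rw [skewDer_one, map_zero, Nat.cast_zero, leadingSkewDer_one]
  · have zero {y : Fun q} (hy : y ∈ degreeLE q N) (i j : ℤ) : coef q (N + 1 : ℕ) i j y = 0 :=
      coef_eq_zero_of_lt hy (.inl (by simp)) j
    simp only [leadingSkewDer, LinearMap.add_apply, LinearMap.sub_apply, LinearMap.smul_apply,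
      zero hxN, zero (skewDer_mem_degreeLE hxN), smul_zero, add_zero, sub_zero]
  · exact_mod_cast coef_skewDer_genMatrix_mul k l hxN hx i j

end SkewDerivation

section HomogeneousSpace

variable {q s : Circle} {μ ν : ℝ}

theorem zpow_sub_zpow_neg_ne_zero (hq : ∀ n : ℕ, 0 < n → q ^ n ≠ 1) {n : ℕ} (hn : 0 < n) :
    (q : ℂ) ^ (n : ℤ) - (q : ℂ) ^ (-n : ℤ) ≠ 0 := by
  intro h
  refine hq (2 * n) (by omega) (Circle.ext ?_)
  rw [sub_eq_zero, zpow_neg, zpow_natCast,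
    ← mul_eq_one_iff_eq_inv₀ (pow_ne_zero _ q.coe_ne_zero)] at h
  rw [Circle.coe_pow, Circle.coe_one, two_mul, pow_add, h]

theorem coef_eq_zero_of_skewDer_eq_zero (hq : ∀ n : ℕ, 0 < n → q ^ n ≠ 1) {N : ℕ} {x : Fun q}
    (hx : x ∈ degreeLE q N) (hD : skewDer q s μ ν x = 0) {i : ℤ} (h : coef q N i 0 x = 0) (j : ℤ) :
    coef q N i j x = 0 := by
  rcases lt_or_ge j 0 with hj | hj
  · exact coef_eq_zero_of_neg (.inr hj) N x
  lift j to ℕ using hj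
  suffices coef q N i (j - 1) x = 0 ∧ coef q N i j x = 0 from this.2
  induction j with
  | zero => exact ⟨coef_eq_zero_of_neg (.inr (by simp)) N x, h⟩
  | succ j ih =>
    have key := coef_skewDer (s := s) (μ := μ) (ν := ν) hx i j
    simp only [leadingSkewDer, hD, LinearMap.add_apply, LinearMap.sub_apply, LinearMap.smul_apply,
      ih.1, ih.2, map_zero, smul_zero, add_zero, sub_zero] at key
    rw [Nat.cast_succ, add_sub_cancel_right]
    refine ⟨ih.2, (smul_eq_zero.mp key.symm).resolve_left (mul_ne_zero q.coe_ne_zero ?_)⟩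
    exact_mod_cast zpow_sub_zpow_neg_ne_zero hq j.succ_pos

theorem mem_degreeLE_of_mem_homogeneousSpace {n : ℕ} {x : Fun q}
    (hx : x ∈ degreeLE q (2 * n + 1)) (hxB : x ∈ homogeneousSpace q s μ ν) :
    x ∈ degreeLE q (2 * n) := by
  refine mem_degreeLE_of_coef_eq_zero hx fun i j => ?_
  have parity : ((-1 : ℂˣ) : ℂ) ^ (2 * n + 1 - 2 * j : ℤ) = -1 := by
    rw [Units.val_neg, Units.val_one]
    exact Odd.neg_one_zpow ⟨n - j, by ring⟩
  have h := coef_hit_diagChar (-1) (2 * n + 1) i j x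
  rw [hit_of_mem_homogeneousSpace (rightIdeal_le_ker_diagChar s μ ν) hxB, parity,
    AlgHom.toLinearMap_apply, map_one, one_smul, neg_one_mul, self_eq_neg] at h
  exact_mod_cast h

theorem congruence_mul_mem_degreeLE (k l : Fin 2) {N : ℕ} {x : Fun q} (hx : x ∈ degreeLE q N) :
    congruence (genMatrix q) (formMatrix s μ ν) k l * x ∈ degreeLE q (N + 2) := by
  simp only [congruence, Finset.sum_mul, smul_mul_assoc, mul_assoc]
  exact sum_mem fun _ _ => sum_mem fun _ _ => Submodule.smul_mem _ _
    (genMatrix_mul_mem_degreeLE _ _ (genMatrix_mul_mem_degreeLE _ _ hx))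

theorem coef_congruence_mul (k l : Fin 2) {N : ℕ} {x : Fun q} (hx : x ∈ degreeLE q N) (i : ℤ) :
    coef q (N + 2) i 0 (congruence (genMatrix q) (formMatrix s μ ν) k l * x) =
      (q : ℂ) ^ (k * (i - (N + 2)) + l * (i - k - (N + 1)) : ℤ) * coef q N (i - k - l) 0 x := by
  have product (m n : Fin 2) : coef q (N + 2) i 0 (genMatrix q k m * (genMatrix q l n * x)) =
      (q : ℂ) ^ (k * (i - (N + 2)) + m * (0 - (N + 2)) : ℤ) *
        ((q : ℂ) ^ (l * (i - k - (N + 1)) + n * (0 - m - (N + 1)) : ℤ) *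
          coef q N (i - k - l) (0 - m - n) x) := by
    have := coef_succ_genMatrix_mul k m (genMatrix_mul_mem_degreeLE l n hx) i 0
    rwa [Nat.cast_succ, coef_succ_genMatrix_mul l n hx, add_assoc, one_add_one_eq_two] at this
  have vanish (j : ℤ) (hj : j < 0) : coef q N (i - k - l) j x = 0 :=
    coef_eq_zero_of_neg (.inr hj) N x
  simp only [congruence, Fin.sum_univ_two, add_mul, smul_mul_assoc, mul_assoc, map_add, map_smul,
    product]
  simp [vanish, formMatrix, zpow_add₀ q.coe_ne_zero, mul_assoc]

variable (q s μ ν) in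
/-- The unital subalgebra generated by `z₁`, `z₂` and `z₃`. -/
def zAlgebra : Subalgebra ℂ (Fun q) :=
  Algebra.adjoin ℂ {z₁ q s μ ν, z₂ q s μ ν, z₃ q s μ ν}

theorem zAlgebra_le_homogeneousSpace (hs : s ^ 2 = q) :
    (zAlgebra q s μ ν).toSubmodule ≤ homogeneousSpace q s μ ν := by
  have mul_top : rightIdeal q s μ ν * ⊤ ≤ rightIdeal q s μ ν := by
    rw [rightIdeal, mul_assoc]
    exact mul_le_mul' le_rfl le_top
  have entry := congruence_mem_homogeneousSpace μ ν hs
  have one : 1 ∈ homogeneousSpace q s μ ν := one_mem_coinvariants (proj q s μ ν)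
  intro x hx
  induction hx using Algebra.adjoin_induction with
  | mem x hx =>
    rcases hx with rfl | rfl | rfl
    · rw [← smul_inv_smul₀ s.coe_ne_zero (z₁ q s μ ν), ← congruence_one_zero μ ν hs]
      exact Submodule.smul_mem _ _ (entry 1 0)
    · exact congruence_one_one (s := s) μ ν ▸ entry 1 1
    · exact congruence_zero_zero (s := s) μ ν ▸ entry 0 0
  | algebraMap r =>
    rw [Algebra.algebraMap_eq_smul_one]
    exact Submodule.smul_mem _ r one
  | add x y _ _ hx hy => exact add_mem hx hy
  | mul x y _ _ hx hy => exact mul_mem_coinvariants mul_top hx hy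

theorem congruence_mem_zAlgebra (hs : s ^ 2 = q) (k l : Fin 2) :
    congruence (genMatrix q) (formMatrix s μ ν) k l ∈ zAlgebra q s μ ν := by
  have mem_z₁ : z₁ q s μ ν ∈ zAlgebra q s μ ν := Algebra.subset_adjoin (by simp)
  match k, l with
  | 0, 0 =>
    rw [congruence_zero_zero]
    exact Algebra.subset_adjoin (by simp)
  | 0, 1 =>
    rw [congruence_zero_one μ ν hs]
    exact add_mem (Subalgebra.smul_mem _ mem_z₁ _) (Subalgebra.smul_mem _ (one_mem _) _)
  | 1, 0 =>
    rw [congruence_one_zero μ ν hs]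
    exact Subalgebra.smul_mem _ mem_z₁ _
  | 1, 1 =>
    rw [congruence_one_one]
    exact Algebra.subset_adjoin (by simp)

theorem exists_mem_zAlgebra_coef_eq_ite (μ ν : ℝ) (hs : s ^ 2 = q) {n k : ℕ} (hk : k ≤ 2 * n) :
    ∃ y ∈ zAlgebra q s μ ν, y ∈ degreeLE q (2 * n) ∧
      ∀ i, coef q (2 * n) i 0 y = if i = k then 1 else 0 := by
  induction n generalizing k with
  | zero =>
    obtain rfl : k = 0 := by omega
    exact ⟨1, one_mem _, one_mem_degreeLE_zero, fun i => by simp [coef_one]⟩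
  | succ n ih =>
    obtain ⟨k, k_le, m, l, rfl⟩ : ∃ k' ≤ 2 * n, ∃ m l : Fin 2, k = k' + m + l := by
      rcases Nat.lt_trichotomy k (2 * n + 1) with h | h | h
      · exact ⟨k, by omega, 0, 0, by simp⟩
      · exact ⟨2 * n, by omega, 1, 0, by simpa using h⟩
      · exact ⟨2 * n, by omega, 1, 1, by rw [Fin.val_one]; omega⟩
    obtain ⟨y, hy, hyN, coef_y⟩ := ih k_le
    let r (i : ℤ) : ℂ := (q : ℂ) ^ (m * (i - (2 * n + 2)) + l * (i - m - (2 * n + 1)) : ℤ)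
    have coef_mul (i : ℤ) : coef q (2 * (n + 1)) i 0
        (congruence (genMatrix q) (formMatrix s μ ν) m l * y) =
          if i = (k + m + l : ℕ) then r i else 0 := by
      have h := coef_congruence_mul (s := s) (μ := μ) (ν := ν) m l hyN i
      rw [Nat.cast_mul, Nat.cast_two, coef_y, mul_ite, mul_one, mul_zero] at h
      rw [mul_add, mul_one, h]
      exact if_congr (by push_cast; omega) rfl rfl
    refine ⟨(r (k + m + l))⁻¹ • (congruence (genMatrix q) (formMatrix s μ ν) m l * y),
      Subalgebra.smul_mem _ (mul_mem (congruence_mem_zAlgebra hs m l) hy) _,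
      Submodule.smul_mem _ _ (congruence_mul_mem_degreeLE m l hyN), fun i => ?_⟩
    rw [map_smul, Nat.cast_succ, coef_mul, smul_eq_mul, mul_ite, mul_zero]
    split_ifs with h
    · subst h
      push_cast
      exact inv_mul_cancel₀ (zpow_ne_zero _ q.coe_ne_zero)
    · rfl

theorem exists_mem_zAlgebra_coef_eq (μ ν : ℝ) (hs : s ^ 2 = q) {n : ℕ} {x : Fun q}
    (hx : x ∈ degreeLE q (2 * n)) :
    ∃ y ∈ zAlgebra q s μ ν, y ∈ degreeLE q (2 * n) ∧
      ∀ i, coef q (2 * n) i 0 y = coef q (2 * n) i 0 x := by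
  choose y hy hyN coef_y using fun k : Fin (2 * n + 1) =>
    exists_mem_zAlgebra_coef_eq_ite μ ν hs (Nat.le_of_lt_succ k.is_lt)
  refine ⟨∑ k : Fin (2 * n + 1), coef q (2 * n) k 0 x • y k,
    sum_mem fun k _ => Subalgebra.smul_mem _ (hy k) _,
    sum_mem fun k _ => Submodule.smul_mem _ _ (hyN k), fun i => ?_⟩
  simp only [map_sum, map_smul, coef_y, smul_eq_mul, mul_ite, mul_one, mul_zero]
  rcases lt_or_ge i 0 with hi | hi
  · rw [coef_eq_zero_of_neg (.inl hi)]
    exact Finset.sum_eq_zero fun k _ => if_neg (by omega)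
  lift i to ℕ using hi
  rcases lt_or_ge (2 * n) i with h | h
  · have := coef_eq_zero_of_lt hx (n := (2 * n : ℕ)) (i := i) (.inr (by omega)) 0
    push_cast at this
    rw [this]
    exact Finset.sum_eq_zero fun k _ => if_neg (by omega)
  · rw [Finset.sum_eq_single ⟨i, by omega⟩ (fun k _ hk => if_neg ?_) (by simp)]
    · simp
    · exact fun h => hk (Fin.ext (by exact_mod_cast h.symm))

theorem mem_zAlgebra_of_mem_homogeneousSpace (hq : ∀ n : ℕ, 0 < n → q ^ n ≠ 1) (hs : s ^ 2 = q)
    {n : ℕ} {x : Fun q} (hx : x ∈ degreeLE q (2 * n)) (hxB : x ∈ homogeneousSpace q s μ ν) :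
    x ∈ zAlgebra q s μ ν := by
  induction n generalizing x with
  | zero =>
    rw [mul_zero, degreeLE, pow_zero, Submodule.mem_one] at hx
    obtain ⟨r, rfl⟩ := hx
    exact algebraMap_mem _ r
  | succ n ih =>
    obtain ⟨y, hy, hyN, coef_y⟩ := exists_mem_zAlgebra_coef_eq μ ν hs hx
    have sub_mem_B := sub_mem hxB (zAlgebra_le_homogeneousSpace hs hy)
    have sub_mem_N := sub_mem hx hyN
    have symbol_eq_zero (i j : ℤ) : coef q (2 * (n + 1) : ℕ) i j (x - y) = 0 :=
      coef_eq_zero_of_skewDer_eq_zero hq sub_mem_N (skewDer_of_mem_homogeneousSpace sub_mem_B)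
        (by push_cast at coef_y ⊢; rw [map_sub, coef_y, sub_self]) j
    have degree_lt : x - y ∈ degreeLE q (2 * n + 1) :=
      mem_degreeLE_of_coef_eq_zero sub_mem_N (by exact_mod_cast symbol_eq_zero)
    rw [← sub_add_cancel x y]
    exact add_mem (ih (mem_degreeLE_of_mem_homogeneousSpace degree_lt sub_mem_B) sub_mem_B) hy

theorem zAlgebra_eq_homogeneousSpace (hq : ∀ n : ℕ, 0 < n → q ^ n ≠ 1) (hs : s ^ 2 = q) :
    (zAlgebra q s μ ν).toSubmodule = homogeneousSpace q s μ ν := by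
  refine le_antisymm (zAlgebra_le_homogeneousSpace hs) fun x hx => ?_
  obtain ⟨N, hN⟩ := exists_mem_degreeLE x
  exact mem_zAlgebra_of_mem_homogeneousSpace hq hs (degreeLE_mono (by omega : N ≤ 2 * N) hN) hx

end HomogeneousSpace

end SLq

end

theorem mainTheorem6 (q s : Circle) (hq : ∀ n : ℕ, 0 < n → q ^ n ≠ 1) (hs : s ^ 2 = q)
    (μ ν : ℝ) :
    -- the left comodule subalgebra of coinvariants is generated by `z₁, z₂, z₃`
    (Algebra.adjoin ℂ {SLq.z₁ q s μ ν, SLq.z₂ q s μ ν, SLq.z₃ q s μ ν}).toSubmodule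
        = SLq.homogeneousSpace q s μ ν ∧
    (∀ x ∈ SLq.homogeneousSpace q s μ ν, Coalgebra.comul (R := ℂ) x ∈
      LinearMap.range ((SLq.homogeneousSpace q s μ ν).subtype.lTensor (SLq.Fun q))) ∧
    -- the generators are real
    IsSelfAdjoint (SLq.z₁ q s μ ν) ∧ IsSelfAdjoint (SLq.z₂ q s μ ν) ∧
    IsSelfAdjoint (SLq.z₃ q s μ ν) ∧
    -- the relations
    SLq.z₁ q s μ ν * SLq.z₂ q s μ ν = ((q : ℂ) ^ 2) • (SLq.z₂ q s μ ν * SLq.z₁ q s μ ν) ∧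
    SLq.z₁ q s μ ν * SLq.z₃ q s μ ν
      = ((q : ℂ) ^ (-2 : ℤ)) • (SLq.z₃ q s μ ν * SLq.z₁ q s μ ν) ∧
    SLq.z₃ q s μ ν * SLq.z₂ q s μ ν
      = algebraMap ℂ (SLq.Fun q) (ν : ℂ) + ((q : ℂ) ^ 2) • SLq.z₁ q s μ ν ^ 2
        + (2 * μ * q : ℂ) • SLq.z₁ q s μ ν :=
  ⟨SLq.zAlgebra_eq_homogeneousSpace hq hs,
    fun _ hx => QuantumHomogeneous.comul_mem_range_lTensor_coinvariants hx,
    SLq.isSelfAdjoint_z₁ μ ν hs, SLq.isSelfAdjoint_z₂ μ ν hs, SLq.isSelfAdjoint_z₃ μ ν hs,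
    SLq.z₁_mul_z₂ μ ν hs, SLq.z₁_mul_z₃ μ ν hs, SLq.z₃_mul_z₂ μ ν hs⟩
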